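/- A function $h:\mathbb R^d\to\mathbb R$ is called DC if it is the difference of two convex functions on $\mathbb R^d$. A set $P\subset\mathbb R^2$ is called a DC graph if it is a rotated copy of $\operatorname{graph}(h|_I)$ for some DC function $h:\mathbb R\to\mathbb R$ and some nonempty compact (possibly degenerate) interval $I\subset\mathbb R$. Let $f(x)=\max(x^5,0)$ for $x\in\mathbb R$, let $g(x)=x^5\cos\frac{\pi}{x}$ for $x\neq 0$, and put $$A=\operatorname{graph}(f)\,\cup\,\operatorname{graph}(-f)\,\cup\,\bigcup_{k=1}^{\infty}\operatorname{graph}\Bigl(g|_{[\frac1{2k+1},\frac1{2k}]}\Bigr)\subset\mathbb R^2 .$$ Then $A$ is a nonempty closed nowhere dense set whose Euclidean distance function $d_A=\operatorname{dist}(\cdot,A)$ is DC on $\mathbb R^2$, but $A$ is not the union of any locally finite system of DC graphs. -/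

import Mathlib

/-- A real function on a real vector space is a DC function if it is the difference of two
convex functions. -/
def IsDC {E : Type*} [AddCommGroup E] [Module ℝ E] (f : E → ℝ) : Prop :=
  ∃ g h : E → ℝ, ConvexOn ℝ Set.univ g ∧ ConvexOn ℝ Set.univ h ∧ ∀ x, f x = g x - h x

/-- The Euclidean plane. -/
abbrev Plane : Type := EuclideanSpace ℝ (Fin 2)

/-- The graph of the restriction of `f` to `s`, as a subset of the Euclidean plane. -/
def planeGraph (f : ℝ → ℝ) (s : Set ℝ) : Set Plane :=
  (fun x : ℝ => (!₂[x, f x] : Plane)) '' s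

/-- The rotation of the plane about the origin by the angle `θ`. -/
noncomputable def planeRotation (θ : ℝ) (p : Plane) : Plane :=
  !₂[Real.cos θ * p 0 - Real.sin θ * p 1, Real.sin θ * p 0 + Real.cos θ * p 1]

/-- A DC graph: a rotated copy of the graph of the restriction of a DC function `f : ℝ → ℝ` to a
nonempty compact (possibly degenerate) interval. -/
def IsDCGraph (P : Set Plane) : Prop :=
  ∃ (f : ℝ → ℝ) (a b θ : ℝ), IsDC f ∧ a ≤ b ∧
    P = planeRotation θ '' planeGraph f (Set.Icc a b)

/-- `A` is the union of a locally finite system of DC graphs. -/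
def IsLocallyFiniteUnionOfDCGraphs (A : Set Plane) : Prop :=
  ∃ S : Set (Set Plane), (∀ P ∈ S, IsDCGraph P) ∧
    LocallyFinite (fun P : S => (P : Set Plane)) ∧ A = ⋃₀ S

/-- The set `A = graph f ∪ graph (-f) ∪ ⋃_{k ≥ 1} graph (g restricted to [1/(2k+1), 1/(2k)])`,
where `f x = max (x ^ 5) 0` and `g x = x ^ 5 * cos (π / x)`. -/
noncomputable def exampleSet : Set Plane :=
  planeGraph (fun x => max (x ^ 5) 0) Set.univ ∪
  planeGraph (fun x => -max (x ^ 5) 0) Set.univ ∪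
  ⋃ (k : ℕ) (_ : 1 ≤ k), planeGraph (fun x => x ^ 5 * Real.cos (Real.pi / x))
    (Set.Icc (1 / (2 * (k : ℝ) + 1)) (1 / (2 * (k : ℝ))))

open Set Filter Topology

/-! Positive part. By the mixing lemma `IsDC.of_continuous_selection` it suffices that at every
point `d_A` equals one of finitely many DC functions. Four suffice: the distances to the upper
graph, to the lower graph and to the whole curve `osc` over `[0, 1/2]`, and a Huber regularization
of `d_A`. The last is DC for any closed nonempty set and equals `d_A` away from `A`; the others are
DC since the three curves have positive reach (`HasReach.isDC_infDist`). Near `A`, a nearest point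
inside a bridge is nearest on the whole curve `osc` as well, while the ends of bridges lie on the
upper or lower graph.

Negative part. Branches of `A` that meet are tangent, so `A` has a second order tangent line at each
point (`exists_tangent_exampleSet`). A DC function is locally Lipschitz, so a DC graph inside `A`
cannot turn back horizontally: the first coordinate is injective along it. Moving right, a bridge
ends on the upper graph, and bridges leave only the lower graph, so the curve never reaches another
bridge (`not_exists_monotone_curve`). Thus each DC graph contains at most one of the points
`(bridgeZero k, 0)`, which accumulate at the origin. -/

/-! ### Convexity by local touching, and mixing of DC functions -/

/-- A continuous function that is touched from below, locally at each point, by a convex function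
is convex. -/
theorem convexOn_of_local_touching {E : Type*} [NormedAddCommGroup E] [NormedSpace ℝ E]
    {F : E → ℝ} (hF : Continuous F)
    (h : ∀ z, ∃ G : E → ℝ, ConvexOn ℝ univ G ∧ G z = F z ∧ ∀ᶠ x in 𝓝 z, G x ≤ F x) :
    ConvexOn ℝ univ F := by
  refine ⟨convex_univ, ?_⟩
  intro a _ b _ s t hs ht hst
  by_contra hcon
  push Not at hcon
  set l : ℝ → E := fun τ => (1 - τ) • a + τ • b with hl
  have hlc : Continuous l := by fun_prop
  have hl2 : ∀ u v : ℝ, l ((u + v) / 2) = (1 / 2 : ℝ) • l u + (1 / 2 : ℝ) • l v := by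
    intro u v; simp only [hl]; module
  set c : ℝ → ℝ := fun τ => (1 - τ) * F a + τ * F b with hc
  set φ : ℝ → ℝ := fun τ => F (l τ) - c τ with hφ
  have hφc : Continuous φ := by fun_prop
  have hφ0 : φ 0 = 0 := by simp [hφ, hl, hc]
  have hφ1 : φ 1 = 0 := by simp [hφ, hl, hc]
  have hs' : s = 1 - t := by linarith
  have ht1 : t ≤ 1 := by linarith
  have hφt : 0 < φ t := by
    simp only [hφ, hl, hc, ← hs']
    simp only [smul_eq_mul] at hcon
    linarith
  obtain ⟨m, hm, hmax⟩ := isCompact_Icc.exists_isMaxOn (⟨0, by simp⟩ : (Icc (0 : ℝ) 1).Nonempty)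
    hφc.continuousOn
  have hM : 0 < φ m := hφt.trans_le (hmax ⟨ht, ht1⟩)
  -- The leftmost maximizer of `φ` has strictly smaller values on its left, so the midpoint
  -- inequality for `G` there is violated.
  have hcomp : IsCompact (Icc (0 : ℝ) 1 ∩ φ ⁻¹' {φ m}) :=
    isCompact_Icc.inter_right (isClosed_singleton.preimage hφc)
  obtain ⟨τ, ⟨⟨hτ01, hτM⟩, hleast⟩⟩ := hcomp.exists_isLeast ⟨m, hm, rfl⟩
  have hτM' : φ τ = φ m := hτM
  have hτ0 : 0 < τ := lt_of_le_of_ne hτ01.1 (by rintro rfl; linarith)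
  have hτ1 : τ < 1 := lt_of_le_of_ne hτ01.2 (by rintro rfl; linarith)
  obtain ⟨G, hG, hGz, hGle⟩ := h (l τ)
  have hev : ∀ᶠ u in 𝓝 τ, G (l u) ≤ F (l u) := hlc.continuousAt.eventually hGle
  have h1 : ∀ᶠ δ in 𝓝[>] (0 : ℝ), G (l (τ - δ)) ≤ F (l (τ - δ)) := by
    have : Tendsto (fun δ : ℝ => τ - δ) (𝓝 0) (𝓝 τ) := by
      have : Continuous (fun δ : ℝ => τ - δ) := by fun_prop
      simpa using this.tendsto 0
    exact (this.mono_left nhdsWithin_le_nhds).eventually hev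
  have h2 : ∀ᶠ δ in 𝓝[>] (0 : ℝ), G (l (τ + δ)) ≤ F (l (τ + δ)) := by
    have : Tendsto (fun δ : ℝ => τ + δ) (𝓝 0) (𝓝 τ) := by
      have : Continuous (fun δ : ℝ => τ + δ) := by fun_prop
      simpa using this.tendsto 0
    exact (this.mono_left nhdsWithin_le_nhds).eventually hev
  have h3 : ∀ᶠ δ in 𝓝[>] (0 : ℝ), δ < min τ (1 - τ) :=
    nhdsWithin_le_nhds (eventually_lt_nhds (lt_min hτ0 (by linarith)))
  have h4 : ∀ᶠ δ in 𝓝[>] (0 : ℝ), 0 < δ := self_mem_nhdsWithin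
  obtain ⟨δ, h1, h2, h3, h4⟩ := (h1.and (h2.and (h3.and h4))).exists
  have h5 := h3.trans_le (min_le_left _ _)
  have h6 := h3.trans_le (min_le_right _ _)
  have hL : φ (τ - δ) < φ m := by
    refine lt_of_le_of_ne (hmax ⟨by linarith, by linarith⟩) fun he => ?_
    have : τ ≤ τ - δ := hleast ⟨⟨by linarith, by linarith⟩, he⟩
    linarith
  have hR : φ (τ + δ) ≤ φ m := hmax ⟨by linarith, by linarith⟩
  have hconv := hG.2 (mem_univ (l (τ - δ))) (mem_univ (l (τ + δ))) (by norm_num : (0 : ℝ) ≤ 1 / 2)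
    (by norm_num : (0 : ℝ) ≤ 1 / 2) (by norm_num)
  rw [← hl2, show (τ - δ + (τ + δ)) / 2 = τ by ring, hGz] at hconv
  simp only [smul_eq_mul] at hconv
  simp only [hφ, hc] at hL hR hτM'
  linarith

section

variable {E : Type*} [AddCommGroup E] [Module ℝ E]

theorem IsDC.min {f g : E → ℝ} (hf : IsDC f) (hg : IsDC g) : IsDC (fun x => min (f x) (g x)) := by
  obtain ⟨a, b, ha, hb, hab⟩ := hf
  obtain ⟨c, d, hc, hd, hcd⟩ := hg
  refine ⟨fun x => a x + c x, fun x => max (a x + d x) (c x + b x), ha.add hc,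
    (ha.add hd).sup (hc.add hb), fun x => ?_⟩
  simp only [hab, hcd]
  rcases le_total (a x + d x) (c x + b x) with h | h
  · rw [max_eq_right h, min_eq_left (by linarith)]; ring
  · rw [max_eq_left h, min_eq_right (by linarith)]; ring

theorem IsDC.inf' {ι : Type*} {G : ι → E → ℝ} (hG : ∀ i, IsDC (G i)) (J : Finset ι)
    (hJ : J.Nonempty) : IsDC (fun x => J.inf' hJ (fun i => G i x)) := by
  induction hJ using Finset.Nonempty.cons_induction with
  | singleton i => simpa using hG i
  | cons i J hi hJ ih =>
    simp only [Finset.inf'_cons hJ]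
    exact (hG i).min ih

end

section

variable {E : Type*} [NormedAddCommGroup E] [NormedSpace ℝ E] [FiniteDimensional ℝ E]

theorem ConvexOn.continuous_of_univ {f : E → ℝ} (hf : ConvexOn ℝ univ f) : Continuous f :=
  continuousOn_univ.1 (by simpa using hf.continuousOn_interior)

theorem IsDC.continuous {f : E → ℝ} (hf : IsDC f) : Continuous f := by
  obtain ⟨a, b, ha, hb, hab⟩ := hf
  rw [show f = fun x => a x - b x from funext hab]
  exact ha.continuous_of_univ.sub hb.continuous_of_univ

/-- The mixing lemma: a continuous selection of finitely many DC functions is DC. -/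
theorem IsDC.of_continuous_selection {ι : Type*} [Finite ι] {F : E → ℝ} (hF : Continuous F)
    {G : ι → E → ℝ} (hG : ∀ i, IsDC (G i)) (hsel : ∀ x, ∃ i, F x = G i x) : IsDC F := by
  classical
  cases nonempty_fintype ι
  have hm : ∀ J : Finset ι, ∃ a b : E → ℝ, ConvexOn ℝ univ a ∧ ConvexOn ℝ univ b ∧
      ∀ (hJ : J.Nonempty) (x : E), J.inf' hJ (fun i => G i x) = a x - b x := by
    intro J
    by_cases hJ : J.Nonempty
    · obtain ⟨a, b, ha, hb, hab⟩ := IsDC.inf' hG J hJ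
      exact ⟨a, b, ha, hb, fun _ => hab⟩
    · exact ⟨0, 0, convexOn_const 0 convex_univ, convexOn_const 0 convex_univ,
        fun h => absurd h hJ⟩
  choose a b ha hb hab using hm
  have hsum : ∀ T : Finset (Finset ι), ConvexOn ℝ univ (fun x => ∑ J ∈ T, b J x) := by
    intro T
    induction T using Finset.induction_on with
    | empty => simpa using convexOn_const (0 : ℝ) (convex_univ (E := E))
    | insert J T hJ ih =>
      simp only [Finset.sum_insert hJ]
      exact (hb J).add ih
  -- Summing over all index sets makes one `C` work at every point: whichever set `J` is active at
  -- `z`, the term `b J` cancels and the remaining ones are convex.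
  set C : E → ℝ := fun x => ∑ J : Finset ι, b J x with hC
  have hCconv : ConvexOn ℝ univ C := hsum _
  refine ⟨fun x => F x + C x, C, ?_, hCconv, fun x => by ring⟩
  refine convexOn_of_local_touching (hF.add hCconv.continuous_of_univ) fun z => ?_
  set J : Finset ι := Finset.univ.filter (fun i => F z = G i z) with hJdef
  have hJ : J.Nonempty := by
    obtain ⟨i, hi⟩ := hsel z
    exact ⟨i, by simp [hJdef, hi]⟩
  have hCJ : ∀ x, J.inf' hJ (fun i => G i x) + C x
      = a J x + ∑ J' ∈ Finset.univ.erase J, b J' x := by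
    intro x
    rw [hab J hJ, hC]
    simp only [← Finset.add_sum_erase Finset.univ (fun J => b J x) (Finset.mem_univ J)]
    ring
  refine ⟨fun x => J.inf' hJ (fun i => G i x) + C x, ?_, ?_, ?_⟩
  · simp only [hCJ]
    exact (ha J).add (hsum _)
  · have : J.inf' hJ (fun i => G i z) = F z := by
      rw [Finset.inf'_congr hJ rfl (g := fun _ => F z)]
      · simp
      · intro i hi
        exact ((Finset.mem_filter.1 hi).2).symm
    simp [this]
  -- Near `z` only indices active at `z` can be selected, so `F` is at least the minimum over `J`.
  · have hev : ∀ᶠ x in 𝓝 z, ∀ i, F z ≠ G i z → F x ≠ G i x := by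
      rw [eventually_all]
      intro i
      by_cases h : F z = G i z
      · simp [h]
      · have := (hF.continuousAt.ne_iff_eventually_ne ((hG i).continuous.continuousAt (x := z))).1 h
        filter_upwards [this] with x hx _ using hx
    filter_upwards [hev] with x hx
    obtain ⟨i, hi⟩ := hsel x
    have hiJ : i ∈ J := by
      simp only [hJdef, Finset.mem_filter, Finset.mem_univ, true_and]
      by_contra h
      exact hx i h hi
    have := Finset.inf'_le (fun i => G i x) hiJ
    linarith

end

/-! ### Distance functions of closed sets and of sets of positive reach -/

/-- A Huber-type regularization of `t ↦ t` on `[0, ∞)`: quadratic for `t ≤ ε`, the identity for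
`ε ≤ t`. -/
noncomputable def huber (ε t : ℝ) : ℝ := t ^ 2 / (2 * ε) + ε / 2 - (max (t - ε) 0) ^ 2 / (2 * ε)

theorem huber_of_le {ε t : ℝ} (hε : 0 < ε) (h : ε ≤ t) : huber ε t = t := by
  rw [huber, max_eq_left (by linarith)]
  field_simp
  ring

theorem huber_of_ge {ε t : ℝ} (h : t ≤ ε) : huber ε t = t ^ 2 / (2 * ε) + ε / 2 := by
  rw [huber, max_eq_right (by linarith)]
  ring

theorem le_huber {ε : ℝ} (hε : 0 < ε) (t : ℝ) : t ≤ huber ε t := by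
  rcases le_total ε t with h | h
  · rw [huber_of_le hε h]
  · have : t ^ 2 / (2 * ε) + ε / 2 - t = (t - ε) ^ 2 / (2 * ε) := by field_simp; ring
    have h2 : 0 ≤ (t - ε) ^ 2 / (2 * ε) := by positivity
    rw [huber_of_ge h]
    linarith

theorem huber_mono {ε s t : ℝ} (hε : 0 < ε) (hs : 0 ≤ s) (hst : s ≤ t) :
    huber ε s ≤ huber ε t := by
  rcases le_total ε s with h | h
  · rwa [huber_of_le hε h, huber_of_le hε (h.trans hst)]
  · have key : ∀ t, s ≤ t → t ≤ ε → huber ε s ≤ huber ε t := by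
      intro t hst h'
      rw [huber_of_ge h, huber_of_ge h']
      gcongr
    rcases le_total t ε with h' | h'
    · exact key t hst h'
    · refine (key ε h le_rfl).trans ?_
      rwa [huber_of_le hε le_rfl, huber_of_le hε h']

theorem continuous_huber (ε : ℝ) : Continuous (huber ε) := by
  unfold huber
  fun_prop

section

variable {E : Type*} [NormedAddCommGroup E] [InnerProductSpace ℝ E]

theorem convexOn_norm_sq_div {ε : ℝ} (hε : 0 < ε) :
    ConvexOn ℝ univ (fun x : E => ‖x‖ ^ 2 / (2 * ε)) := by
  have h : ConvexOn ℝ univ (fun x : E => ‖x‖ ^ 2) :=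
    convexOn_univ_norm.pow (fun x _ => norm_nonneg x) 2
  have := h.smul (c := (2 * ε)⁻¹) (by positivity)
  simpa [div_eq_inv_mul] using this

/-- The function `x ↦ huber ε ‖x - c‖` is semiconcave. -/
theorem convexOn_norm_sq_sub_huber {ε : ℝ} (hε : 0 < ε) (c : E) :
    ConvexOn ℝ univ (fun x : E => ‖x‖ ^ 2 / (2 * ε) - huber ε ‖x - c‖) := by
  have h0 : ConvexOn ℝ univ (fun x : E => ‖x - c‖) := by
    simpa [dist_eq_norm] using convexOn_univ_dist (E := E) c
  have h0' : ConvexOn ℝ univ (fun x : E => ‖x - c‖ - ε) :=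
    (h0.add_const (-ε)).congr fun x _ => (sub_eq_add_neg _ _).symm
  have h1 : ConvexOn ℝ univ (fun x : E => max (‖x - c‖ - ε) 0) :=
    h0'.sup (convexOn_const 0 convex_univ)
  have h2 : ConvexOn ℝ univ (fun x : E => (max (‖x - c‖ - ε) 0) ^ 2) :=
    h1.pow (fun x _ => le_max_right _ _) 2
  have h3 := h2.smul (c := (2 * ε)⁻¹) (by positivity)
  -- After expanding `‖x - c‖ ^ 2` the quadratic terms in `x` cancel; the squared positive part plus
  -- an affine function remains.
  have h4 : ConvexOn ℝ univ (fun x : E => (inner ℝ (ε⁻¹ • c) x : ℝ)) :=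
    (innerₛₗ ℝ (ε⁻¹ • c)).convexOn convex_univ
  have h5 := (h3.add h4).add_const (-(‖c‖ ^ 2 / (2 * ε)) - ε / 2)
  refine h5.congr fun x _ => ?_
  simp only [Pi.add_apply, smul_eq_mul, huber, real_inner_smul_left]
  rw [norm_sub_sq_real, real_inner_comm x c]
  field_simp
  ring

variable [ProperSpace E]

/-- The regularized distance function `huber ε (dist(·, K))` is semiconcave. -/
theorem convexOn_norm_sq_sub_huber_infDist {ε : ℝ} (hε : 0 < ε) {K : Set E} (hK : IsClosed K)
    (hne : K.Nonempty) :
    ConvexOn ℝ univ (fun x : E => ‖x‖ ^ 2 / (2 * ε) - huber ε (Metric.infDist x K)) := by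
  refine convexOn_of_local_touching ?_ fun z => ?_
  · have := (continuous_huber ε).comp (Metric.continuous_infDist_pt K)
    simp only [Function.comp_def] at this
    fun_prop
  · obtain ⟨p, hp, hzp⟩ := hK.exists_infDist_eq_dist hne z
    refine ⟨_, convexOn_norm_sq_sub_huber hε p, ?_, Eventually.of_forall fun x => ?_⟩
    · simp only [hzp, dist_eq_norm]
    · have := huber_mono hε Metric.infDist_nonneg (Metric.infDist_le_dist_of_mem (x := x) hp)
      rw [dist_eq_norm] at this
      linarith

theorem isDC_huber_infDist {ε : ℝ} (hε : 0 < ε) {K : Set E} (hK : IsClosed K)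
    (hne : K.Nonempty) : IsDC (fun x : E => huber ε (Metric.infDist x K)) :=
  ⟨_, _, convexOn_norm_sq_div hε, convexOn_norm_sq_sub_huber_infDist hε hK hne,
    fun x => by ring⟩

/-- If `p` is a nearest point of `K` to `z`, then the open ball of radius `r` that touches `p` from
the side of `z` misses `K`. -/
def HasReach (K : Set E) (r : ℝ) : Prop :=
  ∀ p ∈ K, ∀ z, (∀ q ∈ K, ‖z - p‖ ≤ ‖z - q‖) → ∀ q ∈ K,
    2 * r * inner ℝ (q - p) (z - p) ≤ ‖q - p‖ ^ 2 * ‖z - p‖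

/-- The distance function of a set of positive reach is DC. -/
theorem HasReach.isDC_infDist {K : Set E} {r : ℝ} (h : HasReach K r) (hr : 0 < r)
    (hK : IsClosed K) (hne : K.Nonempty) : IsDC (fun x : E => Metric.infDist x K) := by
  -- With this choice `ρ ≤ ε` gives `r - ρ ≥ ε`, a range where `huber ε` is the identity.
  set ε : ℝ := r / 2 with hε_def
  have hε : 0 < ε := by positivity
  have hcont : Continuous (fun x : E => Metric.infDist x K) := Metric.continuous_infDist_pt K
  have hψ := convexOn_norm_sq_sub_huber_infDist hε hK hne
  have hQ := convexOn_norm_sq_div (E := E) hε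
  set Q : E → ℝ := fun x => ‖x‖ ^ 2 / (2 * ε) with hQdef
  have hQc : Continuous Q := by fun_prop
  have hhc : Continuous (fun x : E => huber ε (Metric.infDist x K)) :=
    (continuous_huber ε).comp hcont
  refine ⟨fun x => Metric.infDist x K + ((Q x - huber ε (Metric.infDist x K)) + Q x),
    fun x => (Q x - huber ε (Metric.infDist x K)) + Q x, ?_, hψ.add hQ, fun x => by ring⟩
  refine convexOn_of_local_touching (by fun_prop) fun z => ?_
  rcases lt_or_ge ε (Metric.infDist z K) with hz | hz
  · refine ⟨fun x => Q x + Q x, hQ.add hQ, ?_, ?_⟩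
    · simp only [huber_of_le hε hz.le]; ring
    · filter_upwards [hcont.continuousAt.eventually (lt_mem_nhds hz)] with x hx
      simp only [huber_of_le hε hx.le]
      linarith
  · obtain ⟨p, hp, hzp⟩ := hK.exists_infDist_eq_dist hne z
    rcases eq_or_ne z p with rfl | hne'
    · refine ⟨_, hψ.add hQ, ?_, Eventually.of_forall fun x => ?_⟩
      · simp [hzp, hQdef]
      · have : 0 ≤ Metric.infDist x K := Metric.infDist_nonneg
        simp only [Pi.add_apply]
        linarith
    · set ρ : ℝ := ‖z - p‖ with hρdef
      have hρ : 0 < ρ := norm_pos_iff.2 (sub_ne_zero.2 hne')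
      have hzρ : Metric.infDist z K = ρ := by rw [hzp, dist_eq_norm]
      -- Centre of the ball of radius `r` touching `p` from the side of `z`. It misses `K`, so `r -
      -- ‖x - c‖` bounds the distance from below, with equality at `z`; replacing the norm by its
      -- Huber version keeps the bound and the equality and makes it semiconvex.
      set c : E := p + (r / ρ) • (z - p) with hc
      have hqc : ∀ q ∈ K, r ≤ ‖q - c‖ := by
        intro q hq
        have h1 := h p hp z (fun q' hq' => by
          rw [← dist_eq_norm, ← dist_eq_norm, ← hzp]
          exact Metric.infDist_le_dist_of_mem hq') q hq
        have h2 : ‖q - c‖ ^ 2 = ‖q - p‖ ^ 2 - (2 * r * inner ℝ (q - p) (z - p)) / ρ + r ^ 2 := by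
          rw [hc, ← sub_sub, norm_sub_sq_real, real_inner_smul_right, norm_smul, ← hρdef,
            Real.norm_of_nonneg (by positivity)]
          field_simp
        have h3 : (2 * r * inner ℝ (q - p) (z - p)) / ρ ≤ ‖q - p‖ ^ 2 := by
          rw [div_le_iff₀ hρ]; exact h1
        exact le_of_sq_le_sq (by linarith) (norm_nonneg _)
      have hlow : ∀ x, r - huber ε ‖x - c‖ ≤ Metric.infDist x K := by
        intro x
        obtain ⟨q, hq, hxq⟩ := hK.exists_infDist_eq_dist hne x
        have h1 := hqc q hq
        have h2 := le_huber hε ‖x - c‖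
        have h3 := dist_triangle q x c
        rw [dist_comm q x, ← hxq, dist_eq_norm, dist_eq_norm] at h3
        linarith
      have hzc : ‖z - c‖ = r - ρ := by
        have : z - c = (1 - r / ρ) • (z - p) := by rw [hc]; module
        rw [this, norm_smul, ← hρdef, Real.norm_eq_abs, abs_of_nonpos]
        · field_simp; ring
        · rw [sub_nonpos, one_le_div hρ]; linarith
      refine ⟨_, (((convexOn_norm_sq_sub_huber hε c).add_const r).add hψ), ?_,
        Eventually.of_forall fun x => ?_⟩
      · simp only [Pi.add_apply, hzc, hzρ]
        rw [huber_of_le hε (by linarith : ε ≤ r - ρ)]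
        simp only [hQdef]
        ring
      · have := hlow x
        simp only [Pi.add_apply, hQdef]
        linarith

end

/-! ### Nearest points and reach of planar graphs -/

namespace Plane

theorem norm_sq (v : Plane) : ‖v‖ ^ 2 = v 0 ^ 2 + v 1 ^ 2 := by
  rw [EuclideanSpace.real_norm_sq_eq, Fin.sum_univ_two]

theorem inner_eq (v w : Plane) : inner ℝ v w = v 0 * w 0 + v 1 * w 1 := by
  rw [PiLp.inner_apply, Fin.sum_univ_two]
  simp [mul_comm]

theorem abs_snd_le (v : Plane) : |v 1| ≤ ‖v‖ := by
  refine abs_le_of_sq_le_sq ?_ (norm_nonneg v)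
  rw [norm_sq]
  nlinarith [sq_nonneg (v 0)]

end Plane

theorem mem_planeGraph {f : ℝ → ℝ} {s : Set ℝ} {p : Plane} :
    p ∈ planeGraph f s ↔ p 0 ∈ s ∧ p 1 = f (p 0) := by
  constructor
  · rintro ⟨x, hx, rfl⟩
    simpa using hx
  · rintro ⟨h, h'⟩
    refine ⟨p 0, h, ?_⟩
    ext i
    fin_cases i <;> simp [h']

theorem isClosed_planeGraph {f : ℝ → ℝ} {s : Set ℝ} (hf : Continuous f) (hs : IsClosed s) :
    IsClosed (planeGraph f s) := by
  have : planeGraph f s = {p : Plane | p 0 ∈ s} ∩ {p : Plane | p 1 = f (p 0)} := by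
    ext p; exact mem_planeGraph
  rw [this]
  have h0 : Continuous fun p : Plane => p 0 := by fun_prop
  have h1 : Continuous fun p : Plane => p 1 := by fun_prop
  exact (hs.preimage h0).inter (isClosed_eq h1 (hf.comp h0))

/-- First order optimality condition for a nearest point on a graph. -/
theorem nearest_point_first_order {φ : ℝ → ℝ} {s C δ x σ v₀ v₁ : ℝ} (hδ : 0 < δ)
    (hE : ∀ t, 0 < t → t < δ → |φ (x + t * σ) - φ x - s * (t * σ)| ≤ C * t ^ 2)
    (hv : ∀ t, 0 < t → t < δ →
      v₀ ^ 2 + v₁ ^ 2 ≤ (v₀ - t * σ) ^ 2 + (v₁ - (φ (x + t * σ) - φ x)) ^ 2) :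
    σ * (v₀ + s * v₁) ≤ 0 := by
  by_contra! hM
  set M := σ * (v₀ + s * v₁) with hMdef
  have hC : 0 ≤ C := by
    have h := (abs_nonneg _).trans (hE (δ / 2) (by linarith) (by linarith))
    by_contra! hneg
    have : C * (δ / 2) ^ 2 < 0 := mul_neg_of_neg_of_pos hneg (by positivity)
    linarith
  -- `B` collects the second order terms: expanding `hv` gives `2 * t * M ≤ t ^ 2 * B`, which fails
  -- once `t < 2 * M / (B + 1)`.
  set B : ℝ := σ ^ 2 + (|s * σ| + C) ^ 2 + 2 * |v₁| * C with hB
  have hB0 : 0 ≤ B := by positivity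
  obtain ⟨t, ht0, ht⟩ : ∃ t, 0 < t ∧ t < min (min δ 1) (2 * M / (B + 1)) :=
    exists_between (lt_min (lt_min hδ one_pos) (by positivity))
  have htδ : t < δ := ht.trans_le ((min_le_left _ _).trans (min_le_left _ _))
  have ht1 : t < 1 := ht.trans_le ((min_le_left _ _).trans (min_le_right _ _))
  have htM : t * (B + 1) < 2 * M := by
    have := ht.trans_le (min_le_right _ _)
    rwa [lt_div_iff₀ (by positivity)] at this
  have h1 := hE t ht0 htδ
  have h2 := hv t ht0 htδ
  set D := φ (x + t * σ) - φ x with hD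
  set e := D - s * (t * σ) with he
  have hDe : D = s * (t * σ) + e := by rw [he]; ring
  have hDabs : |D| ≤ (|s * σ| + C) * t := by
    calc |D| ≤ |s * (t * σ)| + |e| := by rw [hDe]; exact abs_add_le _ _
      _ ≤ |s * σ| * t + C * t := by
        have : |s * (t * σ)| = |s * σ| * t := by
          rw [show s * (t * σ) = (s * σ) * t by ring, abs_mul, abs_of_pos ht0]
        have h3 : C * t ^ 2 ≤ C * t := by
          apply mul_le_mul_of_nonneg_left _ hC
          nlinarith
        linarith
      _ = _ := by ring
  have hD2 : D ^ 2 ≤ ((|s * σ| + C) * t) ^ 2 := sq_le_sq' (abs_le.1 hDabs).1 (abs_le.1 hDabs).2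
  have hv1e : -(v₁ * e) ≤ |v₁| * (C * t ^ 2) := by
    calc -(v₁ * e) ≤ |v₁ * e| := neg_le_abs _
      _ = |v₁| * |e| := abs_mul _ _
      _ ≤ _ := by gcongr
  have h4 : 2 * t * M + 2 * (v₁ * e) ≤ t ^ 2 * σ ^ 2 + D ^ 2 := by
    have : 2 * t * M + 2 * (v₁ * e) = 2 * t * σ * v₀ + 2 * v₁ * D := by rw [hDe, hMdef]; ring
    rw [this]
    linarith
  have h5 : 2 * t * M ≤ t * (t * B) := by
    rw [hB]
    linarith
  have h6 : 2 * M ≤ t * B := by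
    have : t * (2 * M) ≤ t * (t * B) := by linarith
    exact le_of_mul_le_mul_left this ht0
  linarith

section

variable {φ s : ℝ → ℝ} {I : Set ℝ} {C : ℝ}

/-- First order condition for the point of a graph over an interval nearest to a given point. -/
theorem graph_nearest_first_order {x δ σ L : ℝ} {z : Plane} (hδ : 0 < δ)
    (hI : ∀ t, 0 < t → t < δ → x + t * σ ∈ I)
    (hE : ∀ t, 0 < t → t < δ → |φ (x + t * σ) - φ x - s x * (t * σ)| ≤ L * t ^ 2)
    (hz : ∀ q ∈ planeGraph φ I, ‖z - !₂[x, φ x]‖ ≤ ‖z - q‖) :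
    σ * ((z 0 - x) + s x * (z 1 - φ x)) ≤ 0 := by
  refine nearest_point_first_order hδ hE fun t ht ht' => ?_
  have h := hz _ ⟨_, hI t ht ht', rfl⟩
  have h2 := pow_le_pow_left₀ (norm_nonneg _) h 2
  simp only [Plane.norm_sq] at h2
  simp at h2
  linarith

/-- The inner product splits into the first order term, which is nonpositive by `h`, and the Taylor
remainder times the vertical component of `z - p`. -/
theorem reach_ineq_of_first_order {x y : ℝ} {z : Plane}
    (hE : |φ y - φ x - s x * (y - x)| ≤ C * (y - x) ^ 2)
    (h : (y - x) * ((z 0 - x) + s x * (z 1 - φ x)) ≤ 0) :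
    inner ℝ (!₂[y, φ y] - !₂[x, φ x] : Plane) (z - !₂[x, φ x]) ≤
      C * (‖(!₂[y, φ y] - !₂[x, φ x] : Plane)‖ ^ 2 * ‖z - !₂[x, φ x]‖) := by
  have hC : 0 ≤ C * (y - x) ^ 2 := (abs_nonneg _).trans hE
  have hC2 : C * (y - x) ^ 2 ≤ C * ((y - x) ^ 2 + (φ y - φ x) ^ 2) := by
    rcases eq_or_ne y x with rfl | hne
    · simp
    · have : 0 < (y - x) ^ 2 := by
        have := sub_ne_zero.2 hne
        positivity
      have hC0 : 0 ≤ C := nonneg_of_mul_nonneg_left hC this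
      nlinarith [sq_nonneg (φ y - φ x)]
  have h1 := Plane.abs_snd_le (z - !₂[x, φ x])
  rw [Plane.norm_sq, Plane.inner_eq]
  simp at h1 ⊢
  set N := ‖z - !₂[x, φ x]‖
  have h2 : (φ y - φ x - s x * (y - x)) * (z 1 - φ x) ≤ C * (y - x) ^ 2 * N := by
    calc _ ≤ |(φ y - φ x - s x * (y - x)) * (z 1 - φ x)| := le_abs_self _
      _ = |φ y - φ x - s x * (y - x)| * |z 1 - φ x| := abs_mul _ _
      _ ≤ _ := by gcongr
  have h3 := mul_le_mul_of_nonneg_right hC2 (norm_nonneg (z - !₂[x, φ x]))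
  linarith

/-- The graph of a `C^{1,1}` function over a convex set has positive reach. -/
theorem hasReach_planeGraph_of_convex (hI : Convex ℝ I) {r : ℝ} (hr : 0 < r) (hrC : 2 * r * C ≤ 1)
    (hE : ∀ x ∈ I, ∀ y ∈ I, |φ y - φ x - s x * (y - x)| ≤ C * (y - x) ^ 2) :
    HasReach (planeGraph φ I) r := by
  rintro _ ⟨x, hx, rfl⟩ z hz _ ⟨y, hy, rfl⟩
  have hmem : ∀ t : ℝ, 0 < t → t < 1 → x + t * (y - x) ∈ I := fun t ht ht' => by
    have := hI hx hy (by linarith : 0 ≤ 1 - t) ht.le (by ring)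
    convert this using 1
    simp only [smul_eq_mul]; ring
  have h1 := graph_nearest_first_order (s := s) (L := C * (y - x) ^ 2) one_pos hmem
    (fun t ht ht' => by
      have := hE x hx _ (hmem t ht ht')
      rw [add_sub_cancel_left] at this
      refine this.trans (le_of_eq (by ring))) hz
  have h2 := reach_ineq_of_first_order (hE x hx y hy) h1
  have h3 : 0 ≤ ‖(!₂[y, φ y] - !₂[x, φ x] : Plane)‖ ^ 2 * ‖z - !₂[x, φ x]‖ := by positivity
  calc _ ≤ 2 * r * (C * (‖(!₂[y, φ y] - !₂[x, φ x] : Plane)‖ ^ 2 * ‖z - !₂[x, φ x]‖)) := by gcongr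
    _ = (2 * r * C) * (‖(!₂[y, φ y] - !₂[x, φ x] : Plane)‖ ^ 2 * ‖z - !₂[x, φ x]‖) := by ring
    _ ≤ _ := by nlinarith

/-- An entire graph whose second order Taylor remainder is controlled by the slope has positive
reach. -/
theorem hasReach_planeGraph_univ {r : ℝ} (hr : 0 < r) (hC : 1 ≤ C) (hrC : 4 * r * C ≤ 1)
    (hE : ∀ x y, |y - x| ≤ 1 → |φ y - φ x - s x * (y - x)| ≤ C * (1 + |s x|) * (y - x) ^ 2) :
    HasReach (planeGraph φ univ) r := by
  rintro _ ⟨x, -, rfl⟩ z hz _ ⟨y, -, rfl⟩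
  have h1 : ∀ σ : ℝ, |σ| ≤ 1 → σ * ((z 0 - x) + s x * (z 1 - φ x)) ≤ 0 := fun σ hσ =>
    graph_nearest_first_order (s := s) (L := C * (1 + |s x|) * σ ^ 2) one_pos
      (fun _ _ _ => mem_univ _)
      (fun t ht ht' => by
        have := hE x (x + t * σ) (by
          rw [add_sub_cancel_left, abs_mul, abs_of_pos ht]
          nlinarith [abs_nonneg σ])
        rw [add_sub_cancel_left] at this
        refine this.trans (le_of_eq (by ring))) hz
  have h2 : (z 0 - x) + s x * (z 1 - φ x) = 0 := by
    have ha := h1 1 (by simp)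
    have hb := h1 (-1) (by simp)
    linarith
  have hN : ‖z - !₂[x, φ x]‖ ^ 2 = (1 + s x ^ 2) * (z 1 - φ x) ^ 2 := by
    rw [Plane.norm_sq]
    simp
    rw [show z 0 - x = -(s x * (z 1 - φ x)) by linarith]
    ring
  rw [Plane.norm_sq (!₂[y, φ y] - !₂[x, φ x]), Plane.inner_eq]
  simp
  set N := ‖z - !₂[x, φ x]‖
  set v := z 1 - φ x
  -- Since `z - p` is normal to the graph, its vertical component is small where the slope is large;
  -- this absorbs the factor `1 + |s x|` in the remainder.
  have hsv : (1 + |s x|) * |v| ≤ 2 * N := by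
    refine le_of_sq_le_sq ?_ (by positivity)
    rw [mul_pow, mul_pow, hN, sq_abs]
    have : (1 + |s x|) ^ 2 ≤ 2 ^ 2 * (1 + s x ^ 2) := by
      nlinarith [sq_abs (s x), sq_nonneg (|s x| - 1)]
    nlinarith [sq_nonneg v]
  set h := y - x with hh
  set D := φ y - φ x with hD
  -- For `|h| ≥ 1` the bound needs no Taylor estimate, because linear terms are dominated by
  -- squares.
  have hrem : |D - s x * h| ≤ C * (1 + |s x|) * (h ^ 2 + D ^ 2) := by
    rcases le_total |h| 1 with hle | hge
    · refine (hE x y hle).trans ?_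
      have : 0 ≤ C * (1 + |s x|) * D ^ 2 := by positivity
      linarith
    · have a1 : |D - s x * h| ≤ |D| + |s x| * |h| := by
        rw [← abs_mul]; exact abs_sub _ _
      have a2 : |h| ≤ h ^ 2 := by nlinarith [sq_abs h]
      have a3 : |D| ≤ h ^ 2 + D ^ 2 := by nlinarith [sq_abs h, sq_abs D, sq_nonneg (|D| - 1)]
      have a4 : |s x| * |h| ≤ |s x| * (h ^ 2 + D ^ 2) := by
        gcongr
        nlinarith [sq_nonneg D]
      have a5 : 0 ≤ (1 + |s x|) * (h ^ 2 + D ^ 2) := by positivity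
      nlinarith
  have h5 : h * (z 0 - x) + D * v = (D - s x * h) * v := by
    rw [show z 0 - x = -(s x * v) by linarith]; ring
  rw [h5]
  have h6 : (D - s x * h) * v ≤ 2 * C * ((h ^ 2 + D ^ 2) * N) := by
    calc _ ≤ |(D - s x * h) * v| := le_abs_self _
      _ = |D - s x * h| * |v| := abs_mul _ _
      _ ≤ C * (1 + |s x|) * (h ^ 2 + D ^ 2) * |v| := by gcongr
      _ = C * (h ^ 2 + D ^ 2) * ((1 + |s x|) * |v|) := by ring
      _ ≤ C * (h ^ 2 + D ^ 2) * (2 * N) := by gcongr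
      _ = _ := by ring
  have h7 : 0 ≤ (h ^ 2 + D ^ 2) * N := by positivity
  calc 2 * r * ((D - s x * h) * v) ≤ 2 * r * (2 * C * ((h ^ 2 + D ^ 2) * N)) := by gcongr
    _ = (4 * r * C) * ((h ^ 2 + D ^ 2) * N) := by ring
    _ ≤ _ := by nlinarith

end

/-! ### Taylor remainders of the two model functions -/

/-- The function `x ↦ max (x ^ 5) 0`. -/
noncomputable abbrev posQuint (x : ℝ) : ℝ := max (x ^ 5) 0

/-- The derivative of `posQuint`. -/
noncomputable def posQuintSlope (x : ℝ) : ℝ := 5 * max x 0 ^ 4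

/-- The function `x ↦ x ^ 5 * cos (π / x)`. -/
noncomputable abbrev osc (x : ℝ) : ℝ := x ^ 5 * Real.cos (Real.pi / x)

/-- The derivative of `osc`. -/
noncomputable def oscSlope (x : ℝ) : ℝ :=
  5 * x ^ 4 * Real.cos (Real.pi / x) + Real.pi * x ^ 3 * Real.sin (Real.pi / x)

theorem posQuint_of_nonneg {x : ℝ} (hx : 0 ≤ x) : posQuint x = x ^ 5 := max_eq_left (by positivity)

theorem posQuint_of_nonpos {x : ℝ} (hx : x ≤ 0) : posQuint x = 0 :=
  max_eq_right (Odd.pow_nonpos (by decide) hx)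

theorem continuous_posQuint : Continuous posQuint := by unfold posQuint; fun_prop

theorem posQuintSlope_nonneg (x : ℝ) : 0 ≤ posQuintSlope x := by unfold posQuintSlope; positivity

/-- The second derivative grows like `x ^ 3`, so no uniform constant exists; it is dominated by the
slope `5 * x ^ 4`, whence the factor `1 + |posQuintSlope x|`. -/
theorem abs_posQuint_remainder_le (x y : ℝ) (h : |y - x| ≤ 1) :
    |posQuint y - posQuint x - posQuintSlope x * (y - x)| ≤ 31 * (1 + |posQuintSlope x|) * (y - x) ^ 2 := by
  rw [abs_of_nonneg (posQuintSlope_nonneg x)]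
  unfold posQuintSlope
  obtain ⟨h1, h2⟩ := abs_le.1 h
  rcases le_total 0 x with hx | hx
  · rw [max_eq_left hx, posQuint_of_nonneg hx]
    rcases le_total 0 y with hy | hy
    · rw [posQuint_of_nonneg hy]
      have key : y ^ 5 - x ^ 5 - 5 * x ^ 4 * (y - x) = (y - x) ^ 2 *
          (10 * x ^ 3 + 10 * x ^ 2 * (y - x) + 5 * x * (y - x) ^ 2 + (y - x) ^ 3) := by ring
      set k := y - x
      have hk2 : k ^ 2 ≤ 1 := by nlinarith
      have b1 : |10 * x ^ 3 + 10 * x ^ 2 * k + 5 * x * k ^ 2 + k ^ 3|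
          ≤ 10 * x ^ 3 + 10 * x ^ 2 + 5 * x + 1 := by
        have c1 : |10 * x ^ 2 * k| ≤ 10 * x ^ 2 := by
          rw [abs_mul, abs_of_nonneg (by positivity)]
          exact mul_le_of_le_one_right (by positivity) h
        have c2 : |5 * x * k ^ 2| ≤ 5 * x := by
          rw [abs_of_nonneg (by positivity)]
          exact mul_le_of_le_one_right (by positivity) hk2
        have c3 : |k ^ 3| ≤ 1 := by
          rw [abs_pow]; exact pow_le_one₀ (abs_nonneg _) h
        have c4 : |10 * x ^ 3| = 10 * x ^ 3 := abs_of_nonneg (by positivity)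
        have d1 := abs_add_le (10 * x ^ 3 + 10 * x ^ 2 * k + 5 * x * k ^ 2) (k ^ 3)
        have d2 := abs_add_le (10 * x ^ 3 + 10 * x ^ 2 * k) (5 * x * k ^ 2)
        have d3 := abs_add_le (10 * x ^ 3) (10 * x ^ 2 * k)
        linarith
      -- The constant `31 = 10 + 10 + 10 + 1` comes from `x ^ 3 ≤ 1 + 2 * x ^ 4`, `x ^ 2 ≤ 1 + x ^
      -- 4` and `x ≤ 2 + x ^ 4`.
      have b2 : 10 * x ^ 3 + 10 * x ^ 2 + 5 * x + 1 ≤ 31 * (1 + 5 * x ^ 4) := by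
        have e1 : x ^ 2 ≤ 1 + x ^ 4 := by nlinarith [sq_nonneg (x ^ 2 - 1)]
        have e2 : x ≤ 1 + x ^ 2 := by nlinarith [sq_nonneg (x - 1)]
        have e3 : x ^ 3 ≤ x ^ 2 + x ^ 4 := by nlinarith [sq_nonneg (x * (x - 1)), sq_nonneg x]
        nlinarith [sq_nonneg (x ^ 2)]
      rw [key, abs_mul, abs_of_nonneg (sq_nonneg k), mul_comm]
      exact mul_le_mul_of_nonneg_right (b1.trans b2) (sq_nonneg k)
    · rw [posQuint_of_nonpos hy]
      have key : 0 - x ^ 5 - 5 * x ^ 4 * (y - x) = x ^ 4 * (4 * x - 5 * y) := by ring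
      rw [key, abs_of_nonneg (mul_nonneg (by positivity) (by linarith))]
      set k := x - y with hk
      have hk0 : 0 ≤ k := by linarith
      have hxk : x ≤ k := by linarith
      have hk1 : k ≤ 1 := by linarith
      have e1 : x ^ 4 ≤ k := by
        calc x ^ 4 ≤ k ^ 4 := by gcongr
          _ ≤ k ^ 1 := pow_le_pow_of_le_one hk0 hk1 (by norm_num)
          _ = k := pow_one k
      have e2 : x ^ 4 * (4 * x - 5 * y) ≤ k * (5 * k) := by
        apply mul_le_mul e1 (by linarith) (by linarith) hk0
      have e3 : 0 ≤ x ^ 4 * k ^ 2 := by positivity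
      rw [show (y - x) ^ 2 = k ^ 2 by rw [hk]; ring]
      nlinarith [sq_nonneg k]
  · rw [max_eq_right hx, posQuint_of_nonpos hx]
    simp only [sub_zero, ne_eq, OfNat.ofNat_ne_zero, not_false_eq_true, zero_pow, mul_zero,
      zero_mul, add_zero, mul_one]
    rcases le_total 0 y with hy | hy
    · rw [posQuint_of_nonneg hy, abs_of_nonneg (by positivity)]
      have hy1 : y ≤ 1 := by linarith
      calc y ^ 5 ≤ y ^ 2 := pow_le_pow_of_le_one hy hy1 (by norm_num)
        _ ≤ (y - x) ^ 2 := by gcongr; linarith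
        _ ≤ _ := by nlinarith [sq_nonneg (y - x)]
    · rw [posQuint_of_nonpos hy]
      simp only [abs_zero]
      positivity

theorem abs_neg_posQuint_remainder_le (x y : ℝ) (h : |y - x| ≤ 1) :
    |-posQuint y - -posQuint x - -posQuintSlope x * (y - x)|
      ≤ 31 * (1 + |-posQuintSlope x|) * (y - x) ^ 2 := by
  have := abs_posQuint_remainder_le x y h
  rwa [abs_neg, show -posQuint y - -posQuint x - -posQuintSlope x * (y - x)
    = -(posQuint y - posQuint x - posQuintSlope x * (y - x)) by ring, abs_neg]

theorem continuous_pow_succ_mul_bounded {u : ℝ → ℝ} (n : ℕ) (hu : ∀ x, |u x| ≤ 1)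
    (hc : ∀ x ≠ 0, ContinuousAt u x) : Continuous fun x => x ^ (n + 1) * u x := by
  rw [continuous_iff_continuousAt]
  intro x
  rcases eq_or_ne x 0 with rfl | hx
  · have h0 : Tendsto (fun x : ℝ => |x| ^ (n + 1)) (𝓝 0) (𝓝 0) := by
      have : Continuous fun x : ℝ => |x| ^ (n + 1) := by fun_prop
      simpa using this.tendsto 0
    rw [ContinuousAt]
    simp only [ne_eq, Nat.add_eq_zero_iff, one_ne_zero, and_false, not_false_eq_true, zero_pow,
      zero_mul]
    refine squeeze_zero_norm (fun x => ?_) h0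
    rw [Real.norm_eq_abs, abs_mul, abs_pow]
    exact mul_le_of_le_one_right (by positivity) (hu x)
  · exact (continuousAt_id.pow _).mul (hc x hx)

theorem continuousAt_cos_pi_div {x : ℝ} (hx : x ≠ 0) :
    ContinuousAt (fun x => Real.cos (Real.pi / x)) x :=
  Real.continuous_cos.continuousAt.comp (continuousAt_const.div continuousAt_id hx)

theorem continuousAt_sin_pi_div {x : ℝ} (hx : x ≠ 0) :
    ContinuousAt (fun x => Real.sin (Real.pi / x)) x :=
  Real.continuous_sin.continuousAt.comp (continuousAt_const.div continuousAt_id hx)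

theorem continuous_osc : Continuous osc :=
  continuous_pow_succ_mul_bounded 4 (fun _ => Real.abs_cos_le_one _)
    fun _ hx => continuousAt_cos_pi_div hx

theorem hasDerivAt_pi_div {x : ℝ} (hx : x ≠ 0) :
    HasDerivAt (fun x => Real.pi / x) (-(Real.pi / x ^ 2)) x := by
  have := (hasDerivAt_inv hx).const_mul Real.pi
  simpa [div_eq_mul_inv] using this

theorem hasDerivAt_osc {x : ℝ} (hx : x ≠ 0) : HasDerivAt osc (oscSlope x) x := by
  have h := (hasDerivAt_pow 5 x).mul (hasDerivAt_pi_div hx).cos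
  refine h.congr_deriv ?_
  simp only [oscSlope]
  push_cast
  field_simp

theorem hasDerivAt_oscSlope {x : ℝ} (hx : x ≠ 0) :
    HasDerivAt oscSlope (20 * x ^ 3 * Real.cos (Real.pi / x)
      + 8 * Real.pi * x ^ 2 * Real.sin (Real.pi / x)
      - Real.pi ^ 2 * x * Real.cos (Real.pi / x)) x := by
  have h := (((hasDerivAt_pow 4 x).const_mul 5).mul (hasDerivAt_pi_div hx).cos).add
    (((hasDerivAt_pow 3 x).const_mul Real.pi).mul (hasDerivAt_pi_div hx).sin)
  refine h.congr_deriv ?_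
  push_cast
  field_simp
  ring

theorem abs_oscSlope_sub_le {x y : ℝ} (hx : x ∈ Ioc (0 : ℝ) (1 / 2)) (hy : y ∈ Ioc (0 : ℝ) (1 / 2)) :
    |oscSlope y - oscSlope x| ≤ 14 * |y - x| := by
  have := (convex_Ioc (0 : ℝ) (1 / 2)).norm_image_sub_le_of_norm_hasDerivWithin_le (C := 14)
    (fun t ht => (hasDerivAt_oscSlope ht.1.ne').hasDerivWithinAt) (fun t ht => ?_) hx hy
  · simpa [Real.norm_eq_abs] using this
  · obtain ⟨ht0, ht1⟩ := ht
    have hpi := Real.pi_pos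
    have hpi2 := Real.pi_lt_d2
    have hc := Real.abs_cos_le_one (Real.pi / t)
    have hs := Real.abs_sin_le_one (Real.pi / t)
    -- The three bounds are 2.5, 6.3 and about 4.97, with sum below 14.
    have a1 : |20 * t ^ 3 * Real.cos (Real.pi / t)| ≤ 20 * (1 / 2) ^ 3 := by
      rw [abs_mul, abs_of_nonneg (by positivity)]
      calc _ ≤ 20 * t ^ 3 := mul_le_of_le_one_right (by positivity) hc
        _ ≤ _ := by gcongr
    have a2 : |8 * Real.pi * t ^ 2 * Real.sin (Real.pi / t)| ≤ 8 * 3.15 * (1 / 2) ^ 2 := by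
      rw [abs_mul, abs_of_nonneg (by positivity)]
      calc _ ≤ 8 * Real.pi * t ^ 2 := mul_le_of_le_one_right (by positivity) hs
        _ ≤ _ := by gcongr
    have a3 : |Real.pi ^ 2 * t * Real.cos (Real.pi / t)| ≤ 3.15 ^ 2 * (1 / 2) := by
      rw [abs_mul, abs_of_nonneg (by positivity)]
      calc _ ≤ Real.pi ^ 2 * t := mul_le_of_le_one_right (by positivity) hc
        _ ≤ _ := by gcongr
    rw [Real.norm_eq_abs]
    refine (abs_sub _ _).trans ((add_le_add_left (abs_add_le _ _) _).trans ?_)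
    norm_num at a1 a2 a3 ⊢
    linarith

theorem abs_osc_le {y : ℝ} (h0 : 0 ≤ y) : |osc y| ≤ y ^ 5 := by
  rw [abs_mul, abs_of_nonneg (by positivity)]
  exact mul_le_of_le_one_right (by positivity) (Real.abs_cos_le_one _)

theorem abs_oscSlope_le {x : ℝ} (h0 : 0 ≤ x) : |oscSlope x| ≤ 5 * x ^ 4 + 4 * x ^ 3 := by
  have hpi := Real.pi_pos
  have hpi2 := Real.pi_le_four
  refine (abs_add_le _ _).trans (add_le_add ?_ ?_)
  · rw [abs_mul, abs_of_nonneg (by positivity)]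
    exact mul_le_of_le_one_right (by positivity) (Real.abs_cos_le_one _)
  · rw [abs_mul, abs_of_nonneg (by positivity)]
    calc _ ≤ Real.pi * x ^ 3 := mul_le_of_le_one_right (by positivity) (Real.abs_sin_le_one _)
      _ ≤ _ := by gcongr

/-- Mean value inequality for `osc t - oscSlope x * t`, with `oscSlope` Lipschitz. The endpoint 0 is
separate because the derivative formulas need a nonzero argument; there the powers of `x` suffice.
-/
theorem abs_osc_remainder_le (x : ℝ) (hx : x ∈ Icc (0 : ℝ) (1 / 2)) (y : ℝ)
    (hy : y ∈ Icc (0 : ℝ) (1 / 2)) :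
    |osc y - osc x - oscSlope x * (y - x)| ≤ 14 * (y - x) ^ 2 := by
  rcases eq_or_lt_of_le hx.1 with rfl | hx0
  · have h := abs_osc_le hy.1
    have : y ^ 5 ≤ y ^ 2 := pow_le_pow_of_le_one hy.1 (by linarith [hy.2]) (by norm_num)
    have h0 : osc 0 = 0 := by simp [osc]
    have h1 : oscSlope 0 = 0 := by simp [oscSlope]
    rw [h0, h1, zero_mul, sub_zero, sub_zero, sub_zero]
    nlinarith [sq_nonneg y]
  rcases eq_or_lt_of_le hy.1 with rfl | hy0
  · have h := abs_osc_le hx.1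
    have h' := abs_oscSlope_le hx.1
    have e1 : x ^ 5 ≤ x ^ 2 := pow_le_pow_of_le_one hx.1 (by linarith [hx.2]) (by norm_num)
    have e2 : x ^ 4 ≤ x ^ 2 := pow_le_pow_of_le_one hx.1 (by linarith [hx.2]) (by norm_num)
    have e3 : |oscSlope x * x| ≤ (5 * x ^ 4 + 4 * x ^ 3) * x := by
      rw [abs_mul, abs_of_nonneg hx.1]
      gcongr
    have e4 := abs_sub (oscSlope x * x) (osc x)
    have e5 : osc 0 - osc x - oscSlope x * (0 - x) = oscSlope x * x - osc x := by
      simp [osc]; ring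
    rw [e5, zero_sub, neg_sq]
    have : (5 * x ^ 4 + 4 * x ^ 3) * x = 5 * x ^ 5 + 4 * x ^ 4 := by ring
    nlinarith [sq_nonneg x]
  have hseg : uIcc x y ⊆ Ioc (0 : ℝ) (1 / 2) := fun t ht => by
    rcases le_total x y with h | h
    · rw [uIcc_of_le h] at ht; exact ⟨hx0.trans_le ht.1, ht.2.trans hy.2⟩
    · rw [uIcc_of_ge h] at ht; exact ⟨hy0.trans_le ht.1, ht.2.trans hx.2⟩
  have := (convex_uIcc x y).norm_image_sub_le_of_norm_hasDerivWithin_le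
    (f := fun t => osc t - oscSlope x * t) (f' := fun t => oscSlope t - oscSlope x)
    (C := 14 * |y - x|) (x := x) (y := y)
    (fun t ht => ((hasDerivAt_osc (hseg ht).1.ne').sub
      (by simpa using (hasDerivAt_id t).const_mul (oscSlope x))).hasDerivWithinAt)
    (fun t ht => by
      rw [Real.norm_eq_abs]
      refine (abs_oscSlope_sub_le ⟨hx0, hx.2⟩ (hseg ht)).trans ?_
      have := abs_sub_left_of_mem_uIcc ht
      gcongr) left_mem_uIcc right_mem_uIcc
  rw [Real.norm_eq_abs, Real.norm_eq_abs] at this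
  calc _ = |osc y - oscSlope x * y - (osc x - oscSlope x * x)| := by congr 1; ring
    _ ≤ _ := this
    _ = _ := by rw [mul_assoc, ← sq, sq_abs]

/-! ### The set as a union of three closed graphs -/

/-- The abscissae of the points of the bridges, and zero. -/
def oscDomain : Set ℝ :=
  {x | x ∈ Icc (0 : ℝ) (1 / 2) ∧ 0 ≤ x * Real.sin (Real.pi / x)}

/-- The factor `x` in the defining inequality makes its right side continuous at 0. -/
theorem isClosed_oscDomain : IsClosed oscDomain := by
  have h : Continuous fun x : ℝ => x * Real.sin (Real.pi / x) := by
    simpa using continuous_pow_succ_mul_bounded 0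
      (fun x => Real.abs_sin_le_one (Real.pi / x)) fun x hx => continuousAt_sin_pi_div hx
  exact isClosed_Icc.inter (isClosed_le continuous_const h)

theorem sin_nonneg_of_mem_oscDomain {x : ℝ} (hx : x ∈ oscDomain) (h0 : x ≠ 0) :
    0 ≤ Real.sin (Real.pi / x) :=
  nonneg_of_mul_nonneg_right hx.2 (lt_of_le_of_ne hx.1.1 h0.symm)

theorem mem_oscDomain_of_mem_Icc {k : ℕ} (hk : 1 ≤ k) {x : ℝ}
    (hx : x ∈ Icc (1 / (2 * (k : ℝ) + 1)) (1 / (2 * (k : ℝ)))) : x ∈ oscDomain := by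
  have hk' : (1 : ℝ) ≤ k := by exact_mod_cast hk
  have hx0 : 0 < x := lt_of_lt_of_le (by positivity) hx.1
  have h1 : 1 / x ≤ 2 * k + 1 := by
    rw [div_le_iff₀ hx0]
    have := hx.1
    rw [div_le_iff₀ (by positivity)] at this
    linarith
  have h2 : 2 * k ≤ 1 / x := by
    rw [le_div_iff₀ hx0]
    have := hx.2
    rw [le_div_iff₀ (by positivity)] at this
    linarith
  refine ⟨⟨hx0.le, hx.2.trans ?_⟩, mul_nonneg hx0.le ?_⟩
  · apply one_div_le_one_div_of_le <;> linarith
  · have hpi := Real.pi_pos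
    rw [← Real.sin_sub_nat_mul_two_pi (Real.pi / x) k]
    have : Real.pi / x = Real.pi * (1 / x) := by ring
    rw [this]
    apply Real.sin_nonneg_of_nonneg_of_le_pi <;> nlinarith

theorem exists_of_mem_oscDomain {x : ℝ} (hx : x ∈ oscDomain) (h0 : x ≠ 0) :
    ∃ k : ℕ, 1 ≤ k ∧ x ∈ Icc (1 / (2 * (k : ℝ) + 1)) (1 / (2 * (k : ℝ))) := by
  have hs := sin_nonneg_of_mem_oscDomain hx h0
  obtain ⟨⟨hx0, hx1⟩, -⟩ := hx
  replace hx0 : 0 < x := lt_of_le_of_ne hx0 h0.symm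
  have hpi := Real.pi_pos
  set w := 1 / x with hw
  have hw2 : 2 ≤ w := by rw [hw, le_div_iff₀ hx0]; linarith
  have hxw : x = 1 / w := by simp [hw]
  set k := ⌊w / 2⌋₊ with hk
  have hk1 : 1 ≤ k := Nat.le_floor (by norm_num; linarith)
  have hk1' : (1 : ℝ) ≤ k := by exact_mod_cast hk1
  have hle : (k : ℝ) ≤ w / 2 := Nat.floor_le (by linarith)
  have hlt : w / 2 < k + 1 := Nat.lt_floor_add_one _
  refine ⟨k, hk1, ?_⟩
  have hw3 : w ≤ 2 * k + 1 := by
    by_contra! hcon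
    have : Real.sin (Real.pi / x) < 0 := by
      rw [← Real.sin_sub_nat_mul_two_pi (Real.pi / x) (k + 1),
        show Real.pi / x = Real.pi * w by rw [hw]; ring]
      push_cast
      apply Real.sin_neg_of_neg_of_neg_pi_lt <;> nlinarith
    linarith
  rw [hxw]
  constructor <;> apply one_div_le_one_div_of_le <;> linarith

/-- The abscissa 0 adds only the origin, which is already on the upper graph. -/
theorem exampleSet_eq : exampleSet =
    planeGraph posQuint univ ∪ planeGraph (fun x => -posQuint x) univ ∪ planeGraph osc oscDomain := by
  apply Subset.antisymm
  · rintro p (hp | hp)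
    · exact Or.inl hp
    · simp only [mem_iUnion] at hp
      obtain ⟨k, hk, x, hx, rfl⟩ := hp
      exact Or.inr ⟨x, mem_oscDomain_of_mem_Icc hk hx, rfl⟩
  · rintro p (hp | ⟨x, hx, rfl⟩)
    · exact Or.inl hp
    · rcases eq_or_ne x 0 with rfl | h0
      · exact Or.inl (Or.inl ⟨0, mem_univ _, by simp⟩)
      · obtain ⟨k, hk, hxk⟩ := exists_of_mem_oscDomain hx h0
        refine Or.inr ?_
        simp only [mem_iUnion]
        exact ⟨k, hk, x, hxk, rfl⟩

theorem mem_exampleSet {p : Plane} : p ∈ exampleSet ↔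
    p 1 = posQuint (p 0) ∨ p 1 = -posQuint (p 0) ∨ (p 0 ∈ oscDomain ∧ p 1 = osc (p 0)) := by
  rw [exampleSet_eq]
  simp only [mem_union, mem_planeGraph, mem_univ, true_and, or_assoc]

theorem isClosed_exampleSet : IsClosed exampleSet := by
  rw [exampleSet_eq]
  exact ((isClosed_planeGraph continuous_posQuint isClosed_univ).union
    (isClosed_planeGraph continuous_posQuint.neg isClosed_univ)).union
    (isClosed_planeGraph continuous_osc isClosed_oscDomain)

theorem exampleSet_nonempty : exampleSet.Nonempty :=
  ⟨!₂[0, 0], mem_exampleSet.2 (Or.inl (by simp))⟩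

/-- Each vertical line meets the closed set in at most three points, so there is no interior. -/
theorem isNowhereDense_exampleSet : IsNowhereDense exampleSet := by
  rw [IsNowhereDense, isClosed_exampleSet.closure_eq, eq_empty_iff_forall_notMem]
  intro p hp
  have hc : Continuous fun t : ℝ => (!₂[p 0, t] : Plane) := by fun_prop
  have hp' : (!₂[p 0, p 1] : Plane) = p := by ext i; fin_cases i <;> simp
  have hnhds : {t : ℝ | (!₂[p 0, t] : Plane) ∈ exampleSet} ∈ 𝓝 (p 1) :=
    hc.continuousAt.preimage_mem_nhds (by rw [hp']; exact mem_interior_iff_mem_nhds.1 hp)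
  refine infinite_of_mem_nhds _ hnhds ?_
  refine Set.Finite.subset (toFinite {posQuint (p 0), -posQuint (p 0), osc (p 0)}) fun t ht => ?_
  rw [mem_ofPred_eq, mem_exampleSet] at ht
  simp only [mem_insert_iff, mem_singleton_iff]
  simp at ht ⊢
  tauto

/-! ### The distance function is DC -/

theorem norm_le_norm_sub_of_inner_le {v w : Plane} {C : ℝ}
    (h : inner ℝ w v ≤ C * (‖w‖ ^ 2 * ‖v‖)) (hv : 2 * (C * ‖v‖) ≤ 1) : ‖v‖ ≤ ‖v - w‖ := by
  refine le_of_sq_le_sq ?_ (norm_nonneg _)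
  rw [norm_sub_sq_real, real_inner_comm]
  have := mul_le_mul_of_nonneg_left hv (sq_nonneg ‖w‖)
  linarith

theorem isDC_infDist_exampleSet : IsDC (fun x : Plane => Metric.infDist x exampleSet) := by
  -- `124 = 4 * 31` is what `hasReach_planeGraph_univ` requires for the constant 31; the constant 14
  -- of `osc` needs less.
  set r : ℝ := 1 / 124 with hr
  have hr0 : 0 < r := by norm_num [hr]
  have hne : ∀ {f : ℝ → ℝ} {s : Set ℝ}, s.Nonempty → (planeGraph f s).Nonempty :=
    fun h => h.image _
  have hsub := exampleSet_eq.symm.subset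
  have h1 : IsDC fun x => Metric.infDist x (planeGraph posQuint univ) :=
    (hasReach_planeGraph_univ (C := 31) hr0 (by norm_num) (by norm_num [hr])
      abs_posQuint_remainder_le).isDC_infDist hr0 (isClosed_planeGraph continuous_posQuint isClosed_univ)
      (hne univ_nonempty)
  have h2 : IsDC fun x => Metric.infDist x (planeGraph (fun x => -posQuint x) univ) :=
    (hasReach_planeGraph_univ (s := fun x => -posQuintSlope x) (C := 31) hr0 (by norm_num)
      (by norm_num [hr])
      abs_neg_posQuint_remainder_le).isDC_infDist hr0
      (isClosed_planeGraph continuous_posQuint.neg isClosed_univ) (hne univ_nonempty)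
  have h3 : IsDC fun x => Metric.infDist x (planeGraph osc (Icc 0 (1 / 2))) :=
    (hasReach_planeGraph_of_convex (convex_Icc _ _) hr0 (by norm_num [hr])
      abs_osc_remainder_le).isDC_infDist hr0
      (isClosed_planeGraph continuous_osc isClosed_Icc) (hne (nonempty_Icc.2 (by norm_num)))
  have h4 := isDC_huber_infDist hr0 isClosed_exampleSet exampleSet_nonempty
  refine IsDC.of_continuous_selection (ι := Fin 4) (Metric.continuous_infDist_pt _)
    (G := ![_, _, _, _]) (by
      intro i
      fin_cases i
      exacts [h1, h2, h3, h4]) fun z => ?_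
  have hnear : ∀ {K : Set Plane} {p : Plane}, K ⊆ exampleSet → p ∈ K →
      Metric.infDist z exampleSet = dist z p →
      Metric.infDist z exampleSet = Metric.infDist z K := fun hK hp h =>
    le_antisymm (Metric.infDist_le_infDist_of_subset hK ⟨_, hp⟩)
      (h ▸ Metric.infDist_le_dist_of_mem hp)
  have hup : planeGraph posQuint univ ⊆ exampleSet := fun q hq => hsub (Or.inl (Or.inl hq))
  have hdown : planeGraph (fun x => -posQuint x) univ ⊆ exampleSet :=
    fun q hq => hsub (Or.inl (Or.inr hq))
  rcases le_total r (Metric.infDist z exampleSet) with hz | hz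
  · exact ⟨3, (huber_of_le hr0 hz).symm⟩
  obtain ⟨p, hp, hzp⟩ := isClosed_exampleSet.exists_infDist_eq_dist exampleSet_nonempty z
  have hp' := hp
  rw [exampleSet_eq] at hp'
  rcases hp' with (hp' | hp') | ⟨x, hx, rfl⟩
  · exact ⟨0, hnear hup hp' hzp⟩
  · exact ⟨1, hnear hdown hp' hzp⟩
  by_cases hx0 : x = 0
  · subst hx0
    exact ⟨0, hnear hup ⟨0, mem_univ _, by simp⟩ hzp⟩
  have hxpos : 0 < x := lt_of_le_of_ne hx.1.1 (Ne.symm hx0)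
  have hsin := sin_nonneg_of_mem_oscDomain hx hx0
  -- A zero of the sine is an end of a bridge, where the cosine is `1` or `-1` and the point lies on
  -- the upper or lower graph.
  rcases eq_or_lt_of_le hsin with hsin | hsin
  · rcases Real.sin_eq_zero_iff_cos_eq.1 hsin.symm with h | h
    · exact ⟨0, hnear hup ⟨x, mem_univ _, by simp [osc, h, posQuint_of_nonneg hxpos.le]⟩ hzp⟩
    · exact ⟨1, hnear hdown ⟨x, mem_univ _, by simp [osc, h, posQuint_of_nonneg hxpos.le]⟩ hzp⟩
  have hx2 : x < 1 / 2 := lt_of_le_of_ne hx.1.2 fun h => by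
    rw [h, show Real.pi / (1 / 2) = 2 * Real.pi by ring, Real.sin_two_pi] at hsin
    exact lt_irrefl _ hsin
  have hnhds : ∀ᶠ y in 𝓝 x, y ∈ oscDomain := by
    filter_upwards [(continuousAt_sin_pi_div hx0).eventually (lt_mem_nhds hsin),
      Ioo_mem_nhds hxpos hx2] with y hy1 hy2
    exact ⟨⟨hy2.1.le, hy2.2.le⟩, mul_nonneg hy2.1.le hy1.le⟩
  obtain ⟨δ, hδ, hball⟩ := Metric.eventually_nhds_iff.1 hnhds
  have hle : ∀ q ∈ planeGraph osc oscDomain, ‖z - !₂[x, osc x]‖ ≤ ‖z - q‖ := fun q hq => by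
    rw [← dist_eq_norm, ← dist_eq_norm, ← hzp]
    exact Metric.infDist_le_dist_of_mem (hsub (Or.inr hq))
  -- Inside a bridge both directions are admissible, so the first order condition becomes an
  -- equality: `z - p` is normal to `osc`.
  have hfo : ∀ σ : ℝ, |σ| = 1 → σ * ((z 0 - x) + oscSlope x * (z 1 - osc x)) ≤ 0 := by
    intro σ hσ
    have hmem : ∀ t, 0 < t → t < δ → x + t * σ ∈ oscDomain := fun t ht ht' =>
      hball (by rw [Real.dist_eq, add_sub_cancel_left, abs_mul, hσ, abs_of_pos ht, mul_one]
                exact ht')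
    refine graph_nearest_first_order (s := oscSlope) (L := 14) hδ hmem (fun t ht ht' => ?_) hle
    have := abs_osc_remainder_le x hx.1 _ (hmem t ht ht').1
    rwa [add_sub_cancel_left, mul_pow, ← sq_abs σ, hσ, one_pow, mul_one] at this
  have hnormal : (z 0 - x) + oscSlope x * (z 1 - osc x) = 0 := by
    have ha := hfo 1 (by simp)
    have hb := hfo (-1) (by simp)
    linarith
  refine ⟨2, ?_⟩
  change _ = Metric.infDist z (planeGraph osc (Icc 0 (1 / 2)))
  have hmem : !₂[x, osc x] ∈ planeGraph osc (Icc 0 (1 / 2)) := ⟨x, hx.1, rfl⟩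
  rw [hzp] at hz ⊢
  refine le_antisymm ((Metric.le_infDist ⟨_, hmem⟩).2 ?_) (Metric.infDist_le_dist_of_mem hmem)
  rintro _ ⟨y, hy, rfl⟩
  -- Normality and closeness to `A` force every point of the whole curve over `[0, 1/2]` to be at
  -- least as far from `z` as `p`.
  have hin := reach_ineq_of_first_order (z := z) (abs_osc_remainder_le x hx.1 y hy)
    (by rw [hnormal, mul_zero])
  rw [dist_eq_norm] at hz ⊢
  rw [dist_eq_norm]
  have hz' : ‖z - !₂[x, osc x]‖ ≤ 1 / 124 := hz
  have := norm_le_norm_sub_of_inner_le hin (by linarith)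
  rwa [sub_sub_sub_cancel_right] at this

/-! ### Tangent lines, and DC graphs inside the set -/

/-- All the branches of `exampleSet` through one of its points have the same slope there. -/
theorem exists_common_slope {x y : ℝ} : ∃ s,
    (y = posQuint x → posQuintSlope x = s) ∧ (y = -posQuint x → -posQuintSlope x = s) ∧
    (x ∈ oscDomain ∧ y = osc x → oscSlope x = s) := by
  have hpos : ∀ {x : ℝ}, 0 < x → posQuintSlope x = 5 * x ^ 4 := fun {x} h => by
    rw [posQuintSlope, max_eq_left h.le]
  have hcos : ∀ {x c : ℝ}, 0 < x → x ^ 5 * c = osc x → Real.cos (Real.pi / x) = c :=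
    fun {x c} h he => (mul_left_cancel₀ (by positivity) he).symm
  have hosc0 : oscSlope 0 = 0 := by simp [oscSlope]
  have hq0 : posQuintSlope 0 = 0 := by simp [posQuintSlope]
  by_cases h1 : y = posQuint x
  · refine ⟨posQuintSlope x, fun _ => rfl, fun h2 => ?_, fun ⟨h3, h4⟩ => ?_⟩
    · have h0 : posQuint x = 0 := by linarith
      have hx : x ≤ 0 := by
        by_contra! h
        rw [posQuint_of_nonneg h.le] at h0
        have : 0 < x ^ 5 := by positivity
        linarith
      simp [posQuintSlope, max_eq_right hx]
    · rcases eq_or_lt_of_le h3.1.1 with rfl | hx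
      · rw [hosc0, hq0]
      · rw [h1, posQuint_of_nonneg hx.le] at h4
        -- Contact with the upper graph means that the cosine is 1, so the sine vanishes and with it
        -- the term `π * x ^ 3 * sin` of the slope.
        have hc := hcos (c := 1) hx (by rw [mul_one, h4])
        rw [oscSlope, Real.sin_eq_zero_iff_cos_eq.2 (Or.inl hc), hc, hpos hx]
        ring
  · by_cases h2 : y = -posQuint x
    · refine ⟨-posQuintSlope x, fun h => absurd h h1, fun _ => rfl, fun ⟨h3, h4⟩ => ?_⟩
      rcases eq_or_lt_of_le h3.1.1 with rfl | hx
      · rw [hosc0, hq0, neg_zero]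
      · rw [h2, posQuint_of_nonneg hx.le] at h4
        have hc := hcos (c := -1) hx (by rw [← h4]; ring)
        rw [oscSlope, Real.sin_eq_zero_iff_cos_eq.2 (Or.inr hc), hc, hpos hx]
        ring
    · exact ⟨oscSlope x, fun h => absurd h h1, fun h => absurd h h2, fun _ => rfl⟩

/-- A closed branch that misses `p` contributes nothing near `p`; along a branch through `p` the
Taylor estimate applies. -/
theorem eventually_tangent_planeGraph {φ s : ℝ → ℝ} {I : Set ℝ} {C c : ℝ} {p : Plane}
    (hK : IsClosed (planeGraph φ I)) (hs : p ∈ planeGraph φ I → s (p 0) = c)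
    (hE : p 0 ∈ I → ∀ y ∈ I, |y - p 0| ≤ 1 →
      |φ y - φ (p 0) - s (p 0) * (y - p 0)| ≤ C * (y - p 0) ^ 2) :
    ∀ᶠ q in 𝓝 p, q ∈ planeGraph φ I →
      |q 1 - p 1 - c * (q 0 - p 0)| ≤ C * (q 0 - p 0) ^ 2 := by
  by_cases hp : p ∈ planeGraph φ I
  · have hc : Continuous fun q : Plane => |q 0 - p 0| := by fun_prop
    have hlt : |p 0 - p 0| < 1 := by rw [sub_self, abs_zero]; exact one_pos
    filter_upwards [hc.continuousAt.eventually (gt_mem_nhds hlt)] with q hq hqK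
    have := hs hp
    rw [mem_planeGraph] at hp hqK
    rw [hp.2, hqK.2, ← this]
    exact hE hp.1 _ hqK.1 hq.le
  · filter_upwards [hK.isOpen_compl.mem_nhds hp] with q hq hqK
    exact absurd hqK hq

/-- At each of its points, `exampleSet` has a tangent line of second order. -/
theorem exists_tangent_exampleSet (p : Plane) : ∃ s C : ℝ, 0 ≤ C ∧ ∀ᶠ q in 𝓝 p, q ∈ exampleSet →
    |q 1 - p 1 - s * (q 0 - p 0)| ≤ C * (q 0 - p 0) ^ 2 := by
  obtain ⟨s, h1, h2, h3⟩ := exists_common_slope (x := p 0) (y := p 1)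
  set C := 31 * (1 + |posQuintSlope (p 0)|) with hC
  have hC14 : 14 ≤ C := by
    have := abs_nonneg (posQuintSlope (p 0))
    linarith
  refine ⟨s, C, by linarith, ?_⟩
  have e1 := eventually_tangent_planeGraph (p := p) (C := C) (c := s) (s := posQuintSlope)
    (isClosed_planeGraph continuous_posQuint isClosed_univ)
    (fun h => h1 (mem_planeGraph.1 h).2) (fun _ y _ => abs_posQuint_remainder_le _ y)
  have e2 := eventually_tangent_planeGraph (p := p) (C := C) (c := s)
    (s := fun x => -posQuintSlope x)
    (isClosed_planeGraph continuous_posQuint.neg isClosed_univ)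
    (fun h => h2 (mem_planeGraph.1 h).2) (fun _ y _ h => by
      simpa only [hC, abs_neg, Pi.neg_apply] using abs_neg_posQuint_remainder_le _ y h)
  have e3 := eventually_tangent_planeGraph (p := p) (C := C) (c := s) (s := oscSlope)
    (isClosed_planeGraph continuous_osc isClosed_oscDomain)
    (fun h => h3 (mem_planeGraph.1 h)) (fun hx y hy _ =>
      (abs_osc_remainder_le _ hx.1 y hy.1).trans (by gcongr))
  filter_upwards [e1, e2, e3] with q h1 h2 h3 hq
  rw [exampleSet_eq] at hq
  rcases hq with (hq | hq) | hq
  exacts [h1 hq, h2 hq, h3 hq]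

theorem ConvexOn.eventually_abs_sub_le {f : ℝ → ℝ} (hf : ConvexOn ℝ univ f) (x : ℝ) :
    ∃ L : ℝ, 0 ≤ L ∧ ∀ᶠ y in 𝓝 x, |f y - f x| ≤ L * |y - x| := by
  obtain ⟨L, t, ht, hL⟩ := hf.locallyLipschitzOn isOpen_univ (mem_univ x)
  rw [nhdsWithin_univ] at ht
  refine ⟨L, L.2, ?_⟩
  filter_upwards [ht] with y hy
  simpa [Real.dist_eq] using hL.dist_le_mul y hy x (mem_of_mem_nhds ht)

theorem IsDC.eventually_abs_sub_le {f : ℝ → ℝ} (hf : IsDC f) (x : ℝ) :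
    ∃ L : ℝ, 0 ≤ L ∧ ∀ᶠ y in 𝓝 x, |f y - f x| ≤ L * |y - x| := by
  obtain ⟨g, h, hg, hh, hgh⟩ := hf
  obtain ⟨L, hL, h1⟩ := hg.eventually_abs_sub_le x
  obtain ⟨M, hM, h2⟩ := hh.eventually_abs_sub_le x
  refine ⟨L + M, by positivity, ?_⟩
  filter_upwards [h1, h2] with y h1 h2
  rw [hgh, hgh, show g y - h y - (g x - h x) = (g y - g x) - (h y - h x) by ring]
  linarith [abs_sub (g y - g x) (h y - h x)]

/-- Along a DC graph that is contained in `exampleSet`, the first coordinate has no local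
extremum. -/
theorem not_isLocalExtr_of_mem_exampleSet {h : ℝ → ℝ} (hh : IsDC h) {a b θ ξ₀ : ℝ}
    (hA : ∀ ξ ∈ Icc a b, planeRotation θ !₂[ξ, h ξ] ∈ exampleSet) (hξ₀ : ξ₀ ∈ Ioo a b) :
    ¬ IsLocalExtr (fun ξ => planeRotation θ !₂[ξ, h ξ] 0) ξ₀ := by
  intro hext
  set X : ℝ → ℝ := fun ξ => planeRotation θ !₂[ξ, h ξ] 0 with hX
  set Y : ℝ → ℝ := fun ξ => planeRotation θ !₂[ξ, h ξ] 1 with hY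
  have hXe : ∀ ξ, X ξ = Real.cos θ * ξ - Real.sin θ * h ξ := fun ξ => by simp [hX, planeRotation]
  have hYe : ∀ ξ, Y ξ = Real.sin θ * ξ + Real.cos θ * h ξ := fun ξ => by simp [hY, planeRotation]
  have hcont : Continuous fun ξ => planeRotation θ !₂[ξ, h ξ] := by
    have := hh.continuous
    unfold planeRotation
    simp
    fun_prop
  obtain ⟨σ, hσ, hsign⟩ : ∃ σ : ℝ, |σ| = 1 ∧ ∀ᶠ ξ in 𝓝 ξ₀, X ξ - X ξ₀ = σ * |X ξ - X ξ₀| := by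
    rcases hext with h | h
    · refine ⟨1, by simp, h.mono fun ξ hξ => ?_⟩
      rw [abs_of_nonneg (sub_nonneg.2 hξ), one_mul]
    · refine ⟨-1, by simp, h.mono fun ξ hξ => ?_⟩
      rw [abs_of_nonpos (sub_nonpos.2 hξ)]
      ring
  obtain ⟨s, C, hC, htan⟩ := exists_tangent_exampleSet (planeRotation θ !₂[ξ₀, h ξ₀])
  obtain ⟨L, hL, hlip⟩ := hh.eventually_abs_sub_le ξ₀
  set κ := Real.cos θ + s * Real.sin θ with hκ
  have hsmall : ∀ᶠ ξ in 𝓝 ξ₀, C * (1 + L) ^ 2 * |ξ - ξ₀| < 1 := by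
    have : Continuous fun ξ => C * (1 + L) ^ 2 * |ξ - ξ₀| := by fun_prop
    exact this.continuousAt.eventually (gt_mem_nhds (by simp))
  obtain ⟨δ, hδ, hball⟩ := Metric.eventually_nhds_iff.1
    (hsign.and ((hcont.continuousAt.eventually htan).and
      (hlip.and (hsmall.and (Icc_mem_nhds hξ₀.1 hξ₀.2)))))
  -- At an extremum `DX` has a fixed sign, so the sign of `τ` can be chosen with `τ * (κ * DX) ≤ 0`.
  -- Then `|τ| ≤ |τ - κ * DX|`, while tangency makes the right side of order `τ ^ 2`.
  obtain ⟨τ, hτ, hτκ⟩ : ∃ τ : ℝ, |τ| = δ / 2 ∧ τ * (κ * σ) ≤ 0 := by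
    rcases le_total 0 (κ * σ) with hs | hs
    · exact ⟨-(δ / 2), by rw [abs_neg, abs_of_pos (by positivity)], by nlinarith⟩
    · exact ⟨δ / 2, by rw [abs_of_pos (by positivity)], by nlinarith⟩
  obtain ⟨h1, h2, h3, h4, h5⟩ := hball (y := ξ₀ + τ) (by
    rw [Real.dist_eq, add_sub_cancel_left, hτ]; linarith)
  replace h2 := h2 (hA _ h5)
  change |Y (ξ₀ + τ) - Y ξ₀ - s * (X (ξ₀ + τ) - X ξ₀)| ≤ C * (X (ξ₀ + τ) - X ξ₀) ^ 2 at h2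
  rw [add_sub_cancel_left] at h3 h4
  set DX := X (ξ₀ + τ) - X ξ₀ with hDX
  set DY := Y (ξ₀ + τ) - Y ξ₀ with hDY
  have hcs := Real.sin_sq_add_cos_sq θ
  -- The inverse rotation recovers the parameter increment.
  have hid : τ = Real.cos θ * DX + Real.sin θ * DY := by
    rw [hDX, hDY, hXe, hXe, hYe, hYe]
    linear_combination (-τ) * hcs
  have hDXle : |DX| ≤ (1 + L) * |τ| := by
    rw [hDX, hXe, hXe]
    calc _ = |Real.cos θ * τ - Real.sin θ * (h (ξ₀ + τ) - h ξ₀)| := by congr 1; ring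
      _ ≤ |Real.cos θ| * |τ| + |Real.sin θ| * |h (ξ₀ + τ) - h ξ₀| := by
        rw [← abs_mul, ← abs_mul]; exact abs_sub _ _
      _ ≤ 1 * |τ| + 1 * (L * |τ|) := by
        gcongr
        exacts [Real.abs_cos_le_one θ, Real.abs_sin_le_one θ]
      _ = _ := by ring
  have hrem : |τ - κ * DX| ≤ C * DX ^ 2 := by
    calc |τ - κ * DX| = |Real.sin θ| * |DY - s * DX| := by
          rw [← abs_mul]; congr 1; rw [hκ]; linear_combination hid
      _ ≤ 1 * |DY - s * DX| := by
        gcongr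
        exact Real.abs_sin_le_one θ
      _ ≤ _ := by rw [one_mul]; exact h2
  have hτle : |τ| ≤ |τ - κ * DX| := by
    apply sq_le_sq.1
    have : τ * (κ * DX) ≤ 0 := by
      rw [h1, show τ * (κ * (σ * |DX|)) = τ * (κ * σ) * |DX| by ring]
      exact mul_nonpos_of_nonpos_of_nonneg hτκ (abs_nonneg _)
    nlinarith [sq_nonneg (κ * DX)]
  have hDX2 : DX ^ 2 ≤ ((1 + L) * |τ|) ^ 2 := by
    rw [← sq_abs DX]
    gcongr
  have hτ0 : 0 < |τ| := by rw [hτ]; positivity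
  have : |τ| ≤ C * (1 + L) ^ 2 * |τ| * |τ| := by
    calc |τ| ≤ C * DX ^ 2 := hτle.trans hrem
      _ ≤ C * ((1 + L) * |τ|) ^ 2 := by gcongr
      _ = _ := by ring
  nlinarith

/-- Two equal values would produce an interior local extremum, as in Rolle's theorem. -/
theorem injOn_fst_of_mem_exampleSet {h : ℝ → ℝ} (hh : IsDC h) {a b θ : ℝ}
    (hA : ∀ ξ ∈ Icc a b, planeRotation θ !₂[ξ, h ξ] ∈ exampleSet) :
    InjOn (fun ξ => planeRotation θ !₂[ξ, h ξ] 0) (Icc a b) := by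
  have hcont : Continuous fun ξ => planeRotation θ !₂[ξ, h ξ] 0 := by
    have := hh.continuous
    simp [planeRotation]
    fun_prop
  have key : ∀ ξ ∈ Icc a b, ∀ η ∈ Icc a b, ξ < η →
      planeRotation θ !₂[ξ, h ξ] 0 ≠ planeRotation θ !₂[η, h η] 0 := by
    intro ξ hξ η hη hlt he
    obtain ⟨c, hc, hext⟩ := exists_isLocalExtr_Ioo hlt hcont.continuousOn he
    exact not_isLocalExtr_of_mem_exampleSet hh hA ⟨hξ.1.trans_lt hc.1, hc.2.trans_le hη.2⟩ hext
  intro ξ hξ η hη he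
  by_contra hne
  rcases lt_or_gt_of_ne hne with hlt | hlt
  · exact key ξ hξ η hη hlt he
  · exact key η hη ξ hξ hlt he.symm

/-! ### Curves visit at most one bridge -/

/-- Just to the right of a point where a bridge meets the upper graph, `π / y` is slightly below a
multiple of `2π`, so no bridge continues there. -/
theorem eventually_sin_pi_div_neg {x : ℝ} (hx : 0 < x) (hcos : Real.cos (Real.pi / x) = 1) :
    ∀ᶠ y in 𝓝[>] x, Real.sin (Real.pi / y) < 0 := by
  obtain ⟨n, hn⟩ := (Real.cos_eq_one_iff _).1 hcos
  have hpi := Real.pi_pos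
  have hc : ContinuousAt (fun y => Real.pi / y) x :=
    continuousAt_const.div continuousAt_id hx.ne'
  have h1 : ∀ᶠ y in 𝓝[>] x, Real.pi / x - Real.pi < Real.pi / y :=
    nhdsWithin_le_nhds (hc.eventually (lt_mem_nhds (by linarith)))
  filter_upwards [h1, self_mem_nhdsWithin] with y hy (hxy : x < y)
  have hlt : Real.pi / y < Real.pi / x := div_lt_div_of_pos_left hpi hx hxy
  rw [← Real.sin_sub_int_mul_two_pi (Real.pi / y) n, hn]
  exact Real.sin_neg_of_neg_of_neg_pi_lt (by linarith) (by linarith)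

/-- The abscissa of a zero of `osc` in the interior of the `k`-th bridge. -/
noncomputable def bridgeZero (k : ℕ) : ℝ := 1 / (2 * (k : ℝ) + 1 / 2)

theorem bridgeZero_pos (k : ℕ) : 0 < bridgeZero k := by unfold bridgeZero; positivity

theorem osc_bridgeZero (k : ℕ) : osc (bridgeZero k) = 0 := by
  have : Real.pi / bridgeZero k = Real.pi / 2 + k * (2 * Real.pi) := by
    unfold bridgeZero
    field_simp
    ring
  rw [osc, this, Real.cos_add_nat_mul_two_pi, Real.cos_pi_div_two, mul_zero]

theorem bridgeZero_mem_oscDomain {k : ℕ} (hk : 1 ≤ k) : bridgeZero k ∈ oscDomain := by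
  have hk' : (1 : ℝ) ≤ k := by exact_mod_cast hk
  refine mem_oscDomain_of_mem_Icc hk ⟨?_, ?_⟩ <;> unfold bridgeZero <;>
    apply one_div_le_one_div_of_le <;> linarith

/-- A curve in `exampleSet` that runs strictly to the right visits at most one bridge. -/
theorem not_exists_monotone_curve {X Y : ℝ → ℝ} (hX : Continuous X) (hY : Continuous Y)
    (hmono : StrictMonoOn X (Icc 0 1))
    (hA : ∀ t ∈ Icc (0 : ℝ) 1, Y t = posQuint (X t) ∨ Y t = -posQuint (X t) ∨
      (X t ∈ oscDomain ∧ Y t = osc (X t))) {m k : ℕ} (hm : 1 ≤ m) (hX0 : X 0 = bridgeZero m)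
    (hX1 : X 1 = bridgeZero k) (hkm : k < m) (hY0 : Y 0 = 0) (hY1 : Y 1 = 0) : False := by
  have hm' : (1 : ℝ) ≤ m := by exact_mod_cast hm
  have hkm' : (k : ℝ) + 1 ≤ m := by exact_mod_cast hkm
  have hpi := Real.pi_pos
  set β : ℝ := 1 / (2 * (m : ℝ)) with hβ
  have hβ0 : 0 < β := by positivity
  have hX0β : X 0 ≤ β := by
    rw [hX0, bridgeZero]
    apply one_div_le_one_div_of_le <;> linarith
  have hβX1 : β < X 1 := by
    rw [hX1, bridgeZero]
    apply one_div_lt_one_div_of_lt <;> [positivity; linarith]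
  have hXpos : ∀ t ∈ Icc (0 : ℝ) 1, 0 < X t := fun t ht =>
    (hX0 ▸ bridgeZero_pos m).trans_le (hmono.monotoneOn (by simp) ht ht.1)
  have hcosβ : Real.cos (Real.pi / β) = 1 := by
    rw [show Real.pi / β = m * (2 * Real.pi) by rw [hβ]; field_simp]
    exact Real.cos_nat_mul_two_pi m
  -- Invariant for a continuous induction on `[0, 1]`: the curve follows `osc` up to `β`, the right
  -- end of the bridge, and the upper graph from then on. At time 1 this contradicts `Y 1 = 0`.
  set s : Set ℝ := {t | (X t ≤ β ∧ Y t = osc (X t)) ∨ (β ≤ X t ∧ Y t = X t ^ 5)} with hs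
  have hclosed : IsClosed s :=
    ((isClosed_le hX continuous_const).inter (isClosed_eq hY (continuous_osc.comp hX))).union
      ((isClosed_le continuous_const hX).inter (isClosed_eq hY (hX.pow 5)))
  have h0s : (0 : ℝ) ∈ s := Or.inl ⟨hX0β, by rw [hY0, hX0, osc_bridgeZero]⟩
  have hall := (hclosed.inter isClosed_Icc).Icc_subset_of_forall_mem_nhdsWithin h0s (b := 1) ?_
  · rcases hall (right_mem_Icc.2 zero_le_one) with h | h
    · linarith [h.1]
    · have : 0 < X 1 ^ 5 := pow_pos (hXpos 1 (by simp)) 5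
      linarith [h.2]
  rintro t ⟨hts, ht⟩
  have htI : t ∈ Icc (0 : ℝ) 1 := Ico_subset_Icc_self ht
  have hXt := hXpos t htI
  have hright : ∀ᶠ u in 𝓝[>] t, u ∈ Icc (0 : ℝ) 1 ∧ X t < X u := by
    filter_upwards [Ioc_mem_nhdsGT ht.2] with u hu
    have huI : u ∈ Icc (0 : ℝ) 1 := ⟨ht.1.trans hu.1.le, hu.2⟩
    exact ⟨huI, hmono htI huI hu.1⟩
  have hnear : ∀ {φ : ℝ → ℝ}, Continuous φ → Y t ≠ φ (X t) → ∀ᶠ u in 𝓝[>] t, Y u ≠ φ (X u) :=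
    fun hφ hne => nhdsWithin_le_nhds
      ((hY.continuousAt.ne_iff_eventually_ne (hφ.comp hX).continuousAt).1 hne)
  have hX5 := pow_pos hXt 5
  by_cases hlt : X t < β
  · have hYt : Y t = osc (X t) := by
      rcases hts with h | h
      · exact h.2
      · linarith [h.1]
    have hlow : bridgeZero m ≤ X t := hX0 ▸ hmono.monotoneOn (by simp) htI ht.1
    have hinv1 : 2 * (m : ℝ) < 1 / X t := by
      rw [lt_div_iff₀ hXt]
      rw [hβ, lt_div_iff₀ (by positivity)] at hlt
      linarith
    have hinv2 : 1 / X t ≤ 2 * (m : ℝ) + 1 / 2 := by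
      rw [div_le_iff₀ hXt]
      rw [bridgeZero, div_le_iff₀ (by positivity)] at hlow
      linarith
    have hπ : Real.pi / X t = Real.pi * (1 / X t) := by ring
    -- Between the zero of the bridge and its right end the reduced angle lies in `(0, π/2]`, so the
    -- cosine is in `[0, 1)` and the curve is off both outer graphs.
    set w := Real.pi / X t - m * (2 * Real.pi) with hw
    have hw0 : 0 < w := by rw [hw, hπ]; nlinarith
    have hw1 : w ≤ Real.pi / 2 := by rw [hw, hπ]; nlinarith
    have hcos : Real.cos (Real.pi / X t) = Real.cos w := by
      rw [hw, Real.cos_sub_nat_mul_two_pi]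
    have hc0 : 0 ≤ Real.cos w := Real.cos_nonneg_of_neg_pi_div_two_le_of_le (by linarith) hw1
    have hc1 : Real.cos w < 1 := by
      rw [← Real.cos_zero]
      exact Real.cos_lt_cos_of_nonneg_of_le_pi_div_two le_rfl hw1 hw0
    have hYt' : Y t = X t ^ 5 * Real.cos w := by rw [hYt, osc, hcos]
    have h1 := hnear continuous_posQuint (by
      rw [posQuint_of_nonneg hXt.le, hYt']; nlinarith)
    have h2 := hnear continuous_posQuint.neg (by
      simp only [Pi.neg_apply]
      rw [posQuint_of_nonneg hXt.le, hYt']; nlinarith)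
    have h3 : ∀ᶠ u in 𝓝[>] t, X u < β :=
      nhdsWithin_le_nhds (hX.continuousAt.eventually (gt_mem_nhds hlt))
    filter_upwards [h1, h2, h3, hright] with u h1 h2 h3 hu
    rcases hA u hu.1 with h | h | h
    · exact absurd h h1
    · exact absurd h h2
    · exact Or.inl ⟨h3.le, h.2⟩
  · push Not at hlt
    have hYt : Y t = X t ^ 5 := by
      rcases hts with h | h
      · rw [h.2, osc, le_antisymm h.1 hlt, hcosβ, mul_one]
      · exact h.2
    have h2 := hnear continuous_posQuint.neg (by
      simp only [Pi.neg_apply]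
      rw [posQuint_of_nonneg hXt.le, hYt]; linarith)
    have h3 : ∀ᶠ u in 𝓝[>] t, ¬ (X u ∈ oscDomain ∧ Y u = osc (X u)) := by
      -- On the upper graph, `osc` is either at a different height, or touches it at the right end
      -- of a bridge, and then its domain stops.
      by_cases hcos : Real.cos (Real.pi / X t) = 1
      · have htend : Tendsto X (𝓝[>] t) (𝓝[>] (X t)) :=
          tendsto_nhdsWithin_iff.2
            ⟨hX.continuousAt.mono_left nhdsWithin_le_nhds, hright.mono fun u hu => hu.2⟩
        filter_upwards [htend.eventually (eventually_sin_pi_div_neg hXt hcos), hright]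
          with u hu hu' h
        exact absurd (sin_nonneg_of_mem_oscDomain h.1 (hXt.trans hu'.2).ne') (not_le.2 hu)
      · have := hnear continuous_osc (by
          rw [hYt, osc]
          intro he
          apply hcos
          exact (mul_left_cancel₀ hX5.ne' (by rw [mul_one]; exact he)).symm)
        filter_upwards [this] with u hu h using hu h.2
    filter_upwards [h2, h3, hright] with u h2 h3 hu
    rcases hA u hu.1 with h | h | h
    · exact Or.inr ⟨hlt.trans hu.2.le, by
        rw [h, posQuint_of_nonneg (hXt.trans hu.2).le]⟩
    · exact absurd h h2
    · exact absurd h h3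

/-- A DC graph contained in `exampleSet` visits at most one bridge. -/
theorem IsDCGraph.not_mem_two_bridges {P : Set Plane} (hP : IsDCGraph P) (hPA : P ⊆ exampleSet)
    {m k : ℕ} (hk : 1 ≤ k) (hkm : k < m) (hm : !₂[bridgeZero m, 0] ∈ P) :
    !₂[bridgeZero k, 0] ∉ P := by
  intro hk'
  obtain ⟨h, a, b, θ, hh, hab, rfl⟩ := hP
  have hA : ∀ ξ ∈ Icc a b, planeRotation θ !₂[ξ, h ξ] ∈ exampleSet := fun ξ hξ =>
    hPA ⟨_, ⟨ξ, hξ, rfl⟩, rfl⟩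
  have hinj := injOn_fst_of_mem_exampleSet hh hA
  obtain ⟨_, ⟨ξ, hξ, rfl⟩, hξm⟩ := hm
  obtain ⟨_, ⟨η, hη, rfl⟩, hηk⟩ := hk'
  beta_reduce at hξm hηk
  -- Reparametrizing from `ξ` to `η` makes their order irrelevant: the curve runs from bridge `m` on
  -- the left to bridge `k` on the right.
  set l : ℝ → ℝ := fun t => (1 - t) * ξ + t * η with hl
  have hlI : ∀ t ∈ Icc (0 : ℝ) 1, l t ∈ Icc a b := fun t ht =>
    convex_Icc a b hξ hη (by linarith [ht.2]) ht.1 (by ring)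
  have hl0 : l 0 = ξ := by simp [hl]
  have hl1 : l 1 = η := by simp [hl]
  have hlt : bridgeZero m < bridgeZero k := by
    have : (k : ℝ) < m := by exact_mod_cast hkm
    unfold bridgeZero
    apply one_div_lt_one_div_of_lt <;> [positivity; linarith]
  have hne : ξ ≠ η := by
    rintro rfl
    rw [hξm] at hηk
    have := congrArg (fun p : Plane => p 0) hηk
    simp at this
    linarith
  have hcont : Continuous fun t => planeRotation θ !₂[l t, h (l t)] := by
    have h1 := hh.continuous
    have h2 : Continuous l := by fun_prop
    unfold planeRotation
    simp
    fun_prop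
  set X : ℝ → ℝ := fun t => planeRotation θ !₂[l t, h (l t)] 0 with hX
  set Y : ℝ → ℝ := fun t => planeRotation θ !₂[l t, h (l t)] 1 with hY
  have hXc : Continuous X := (by fun_prop : Continuous fun p : Plane => p 0).comp hcont
  have hYc : Continuous Y := (by fun_prop : Continuous fun p : Plane => p 1).comp hcont
  have hX0 : X 0 = bridgeZero m := by simp only [hX, hl0, hξm]; simp
  have hX1 : X 1 = bridgeZero k := by simp only [hX, hl1, hηk]; simp
  have hY0 : Y 0 = 0 := by simp only [hY, hl0, hξm]; simp
  have hY1 : Y 1 = 0 := by simp only [hY, hl1, hηk]; simp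
  have hXinj : InjOn X (Icc 0 1) := by
    intro t ht u hu he
    have h1 : l t = l u := hinj (hlI t ht) (hlI u hu) he
    have h2 : (t - u) * (η - ξ) = 0 := by
      simp only [hl] at h1
      linear_combination h1
    rcases mul_eq_zero.1 h2 with h | h
    · linarith
    · exact absurd (by linarith) hne
  have hmono : StrictMonoOn X (Icc 0 1) :=
    hXc.continuousOn.strictMonoOn_of_injOn_Icc zero_le_one (by rw [hX0, hX1]; exact hlt.le) hXinj
  exact not_exists_monotone_curve hXc hYc hmono (fun t ht => mem_exampleSet.1 (hA _ (hlI t ht)))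
    (hk.trans hkm.le) hX0 hX1 hkm hY0 hY1

/-- Infinitely many bridge zeros lie in a neighbourhood of the origin that meets only finitely many
members of the system, so two of them share a DC graph. -/
theorem not_isLocallyFiniteUnionOfDCGraphs_exampleSet :
    ¬ IsLocallyFiniteUnionOfDCGraphs exampleSet := by
  rintro ⟨S, hS, hlf, hA⟩
  -- The shift by one is needed because bridges are indexed from 1.
  set z : ℕ → Plane := fun k => !₂[bridgeZero (k + 1), 0] with hz
  have hzA : ∀ k, z k ∈ ⋃₀ S := fun k => by
    rw [← hA, mem_exampleSet]
    refine Or.inr (Or.inr ?_)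
    simpa [hz, osc_bridgeZero] using
      And.intro (bridgeZero_mem_oscDomain (Nat.succ_le_succ k.zero_le))
        (osc_bridgeZero (k + 1)).symm
  choose P hPS hzP using hzA
  have hlim : Tendsto z atTop (𝓝 !₂[0, 0]) := by
    have h1 : Tendsto (fun k : ℕ => bridgeZero (k + 1)) atTop (𝓝 0) := by
      have h2 : Tendsto (fun k : ℕ => 1 / ((k : ℝ) + 1)) atTop (𝓝 0) :=
        tendsto_one_div_add_atTop_nhds_zero_nat
      refine squeeze_zero (fun k => (bridgeZero_pos _).le) (fun k => ?_) h2
      unfold bridgeZero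
      push_cast
      apply one_div_le_one_div_of_le <;> linarith [(Nat.cast_nonneg k : (0 : ℝ) ≤ k)]
    have hc : Continuous fun t : ℝ => (!₂[t, 0] : Plane) := by fun_prop
    exact (hc.tendsto 0).comp h1
  obtain ⟨U, hU, hfin⟩ := hlf !₂[0, 0]
  obtain ⟨N, hN⟩ := eventually_atTop.1 (hlim.eventually hU)
  have := hfin.to_subtype
  obtain ⟨i, j, hij, he⟩ := Finite.exists_ne_map_eq_of_infinite
    (fun k : ℕ => (⟨⟨P (k + N), hPS _⟩, ⟨z (k + N), hzP _, hN _ (by omega)⟩⟩ :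
      {Q : S | ((Q : Set Plane) ∩ U).Nonempty}))
  have he' : P (i + N) = P (j + N) :=
    congrArg (fun Q => ((Q.1 : S) : Set Plane)) he
  have key : ∀ i j, i < j → P i ≠ P j := fun i j hij he => by
    refine (hS _ (hPS i)).not_mem_two_bridges ?_ (Nat.succ_le_succ i.zero_le)
      (Nat.succ_lt_succ hij) (he ▸ hzP j) (hzP i)
    rw [hA]
    exact subset_sUnion_of_mem (hPS i)
  rcases lt_or_gt_of_ne hij with h | h
  · exact key _ _ (by omega) he'
  · exact key _ _ (by omega) he'.symm

theorem mainTheorem7 :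
    exampleSet.Nonempty ∧ IsClosed exampleSet ∧ IsNowhereDense exampleSet ∧
      IsDC (fun x : Plane => Metric.infDist x exampleSet) ∧
      ¬ IsLocallyFiniteUnionOfDCGraphs exampleSet :=
  ⟨exampleSet_nonempty, isClosed_exampleSet, isNowhereDense_exampleSet,
    isDC_infDist_exampleSet, not_isLocallyFiniteUnionOfDCGraphs_exampleSet⟩
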